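/- Let $\mathcal U$ be a real separable Hilbert space with orthonormal basis $\{\mathfrak u_k\}$, and let $\{\dot W(h),\,h\in\mathcal U\}$ be a zero-mean Gaussian family on a probability space $\mathbb F=(\Omega,\mathcal F,\mathbb P)$ with $\mathbb E\big(\dot W(h_1)\dot W(h_2)\big)=(h_1,h_2)_{\mathcal U}$, where $\mathcal F$ is generated, up to null sets, by the variables $\dot W(h)$. For a multi-index $\alpha\in\mathcal J$ (finitely many non-zero entries $\alpha_k\in\{0,1,2,\dots\}$) put $|\alpha|=\sum_k\alpha_k$ and $\xi_\alpha=\prod_k H_{\alpha_k}(\dot W(\mathfrak u_k))/\sqrt{\alpha_k!}$, where $H_n(x)=(-1)^ne^{x^2/2}\frac{d^n}{dx^n}e^{-x^2/2}$. Let $Q=\{q_k\}$ be a sequence with $q_k\ge 1$ for all $k$, let $r\in\mathbb R$, put $q^{r\alpha}=\prod_k q_k^{r\alpha_k}$, and let $\Lambda_Q$ be the self-adjoint operator with $\Lambda_Q\mathfrak u_k=q_k\mathfrak u_k$, extended to tensor powers. For a real separable Hilbert space $X$, let $(\mathcal L)_{Q,r}(\mathbb F;X)$ be the completion of the set of random elements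 $\eta=\eta_0+\sum_{n=1}^N\frac1{n!}\boldsymbol\delta^{\hat\otimes n}(\eta_n)$, where $\eta_0\in X$, where each $\eta_n\in X\otimes\mathcal U^{\hat\otimes n}$ ($\mathcal U^{\hat\otimes n}$ is the symmetric tensor power) is in the domain of $\Lambda_Q^r$, and where $\boldsymbol\delta^{\hat\otimes n}$ is the $n$-fold iterated Skorokhod integral ($\boldsymbol\delta$ is the adjoint of the Malliavin derivative), with respect to the norm $\|\eta\|_{Q,r;X}^2=\|\eta_0\|_X^2+\sum_{n=1}^N\frac1{(n!)^2}\|\Lambda_Q^r\eta_n\|^2_{X\otimes\mathcal U^{\otimes n}}$. For $\eta\in(\mathcal L)_{Q,r}(\mathbb F;X)$ let $\eta_\alpha\in X$ be its coefficients, that is, the continuous extension of $\eta\mapsto\mathbb E(\eta\,\xi_\alpha)$. Let $(\mathcal L)^{Q,r}(\mathbb F)$ be the dual space of $(\mathcal L)_{Q,r}(\mathbb F)=(\mathcal L)_{Q,r}(\mathbb F;\mathbb R)$ relative to the inner product of $L_2(\mathbb F)$: a formal series $\zeta=\sum_{\alpha\in\mathcal J}\zeta_\alpha\xi_\alpha$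 with $\zeta_\alpha\in\mathbb R$ is an element of $(\mathcal L)^{Q,r}(\mathbb F)$ if there is a continuous linear functional $\langle\!\langle\cdot,\zeta\rangle\!\rangle$ on $(\mathcal L)_{Q,r}(\mathbb F)$ with $\langle\!\langle\xi_\alpha,\zeta\rangle\!\rangle=\zeta_\alpha$ for every $\alpha$. For $\eta\in(\mathcal L)_{Q,r}(\mathbb F;X)$, the duality $\langle\!\langle\eta,\zeta\rangle\!\rangle$ is the element of $X$ with $(x,\langle\!\langle\eta,\zeta\rangle\!\rangle)_X=\langle\!\langle(x,\eta)_X,\zeta\rangle\!\rangle$ for all $x\in X$. Then a formal series $\zeta=\sum_{\alpha\in\mathcal J}\zeta_\alpha\xi_\alpha$ is an element of $(\mathcal L)^{Q,r}(\mathbb F)$ if and only if $$\sum_{\alpha\in\mathcal J}|\alpha|!\;q^{-2r\alpha}\,|\zeta_\alpha|^2<\infty .$$ In this case, for every $\eta\in(\mathcal L)_{Q,r}(\mathbb F;X)$, $$\langle\!\langle\eta,\zeta\rangle\!\rangle=\sum_{\alpha\in\mathcal J}\eta_\alpha\zeta_\alpha ,$$ where the series converges unconditionally in $X$. -/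

import Mathlib

open MeasureTheory ProbabilityTheory
open scoped ENNReal InnerProductSpace

noncomputable section

namespace WhiteNoise

/-- `W` is a zero-mean Gaussian family indexed by the real Hilbert space `U` with
`E (W h₁ W h₂) = (h₁, h₂)`, and, up to `P`-null sets (so that `P` may be complete), the
`σ`-algebra of the probability space is the one generated by the variables `W h`. -/
structure IsWhiteNoise {Ω U : Type*} [MeasurableSpace Ω] [NormedAddCommGroup U]
    [InnerProductSpace ℝ U] (P : Measure Ω) (W : U → Ω → ℝ) : Prop where
  measurable : ∀ h, Measurable (W h)
  gaussian : IsGaussianProcess W P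
  mean_zero : ∀ h, ∫ ω, W h ω ∂P = 0
  covariance : ∀ h₁ h₂, ∫ ω, W h₁ ω * W h₂ ω ∂P = ⟪h₁, h₂⟫_ℝ
  generates : ∀ A : Set Ω, MeasurableSet A → ∃ B : Set Ω,
    MeasurableSet[⨆ h : U, MeasurableSpace.comap (W h) inferInstance] B ∧ A =ᵐ[P] B

section Skorokhod

variable {Ω U ι X Y : Type*} [MeasurableSpace Ω]
  [NormedAddCommGroup U] [InnerProductSpace ℝ U]
  [NormedAddCommGroup X] [InnerProductSpace ℝ X]
  [NormedAddCommGroup Y] [InnerProductSpace ℝ Y]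
  (P : Measure Ω) (W : U → Ω → ℝ) (u : HilbertBasis ι ℝ U)

/-- The Cameron-Martin variable `ξ_α = ∏ₖ H_{αₖ}(W(uₖ)) / √(αₖ!)`; here `Polynomial.hermite n` is
the Hermite polynomial `(-1)ⁿ e^{x²/2} (d/dx)ⁿ e^{-x²/2}`. -/
def xi (α : ι →₀ ℕ) (ω : Ω) : ℝ :=
  α.prod fun k n => Polynomial.aeval (W (u k) ω) (Polynomial.hermite n) / √(n.factorial : ℝ)

/-- The graph of the Malliavin derivative on smooth cylindrical variables:
`D F(W h₁, …, W h_N) = ∑ᵢ ∂ᵢF(W h₁, …, W h_N) hᵢ`, for `F` smooth with all derivatives of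
polynomial growth. -/
def smoothMalliavinGraph : Set (Lp ℝ 2 P × Lp U 2 P) :=
  {p | ∃ (N : ℕ) (h : Fin N → U) (F : (Fin N → ℝ) → ℝ), F.HasTemperateGrowth ∧
    p.1 =ᵐ[P] (fun ω => F fun i => W (h i) ω) ∧
    p.2 =ᵐ[P] fun ω => ∑ i, fderiv ℝ F (fun j => W (h j) ω) (Pi.single i 1) • h i}

/-- `φ` lies in the domain `𝔻^{1,2}` of the (closed) Malliavin derivative, and `D φ = G`. -/
def HasMalliavinDeriv (φ : Lp ℝ 2 P) (G : Lp U 2 P) : Prop :=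
  (φ, G) ∈ closure (smoothMalliavinGraph P W)

/-- `g = δ(f)`, the Skorokhod integral, for `f = ∑ₖ fₖ ⊗ uₖ ∈ L₂(Ω; X ⊗ U)`, given by its
square-summable family of coordinates `fₖ ∈ L₂(Ω; X)`: one has `E (φ g) = E (f, D φ)_U` for all
`φ ∈ 𝔻^{1,2}`. -/
def IsSkorokhod (f : ι → Lp X 2 P) (g : Lp X 2 P) : Prop :=
  Memℓp f 2 ∧ ∀ (φ : Lp ℝ 2 P) (G : Lp U 2 P), HasMalliavinDeriv P W φ G →
    HasSum (fun k => ∫ ω, ⟪u k, G ω⟫_ℝ • f k ω ∂P) (∫ ω, φ ω • g ω ∂P)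

/-- `g = δ ∘ ⋯ ∘ δ (f)` (`n` times). An element of `L₂(Ω; X ⊗ U^{⊗ n})` is given by the
square-summable family of its coordinates in the orthonormal system
`u_{i₁} ⊗ ⋯ ⊗ u_{iₙ}`, and the Skorokhod integral of an `(X ⊗ U^{⊗ n}) ⊗ U`-valued random element
is computed in these coordinates. -/
def IsIteratedSkorokhod : (n : ℕ) → ((Fin n → ι) → Lp X 2 P) → Lp X 2 P → Prop
  | 0, f, g => g = f Fin.elim0
  | n + 1, f, g => Memℓp f 2 ∧ ∃ h : (Fin n → ι) → Lp X 2 P, Memℓp h 2 ∧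
      (∀ j : Fin n → ι, IsSkorokhod P W u (fun k => f (Fin.cons k j)) (h j)) ∧
      IsIteratedSkorokhod n h g

/-- The eigenvalue `∏ⱼ q_{iⱼ}^r` of `Λ_Q^r` on `u_{i₁} ⊗ ⋯ ⊗ u_{iₙ}`. -/
def tensorWeight (q : ι → ℝ) (r : ℝ) {n : ℕ} (i : Fin n → ι) : ℝ := ∏ j, q (i j) ^ r

/-- `c` is the coordinate family of an element of the symmetric tensors `X ⊗ U^{⊗̂ n}` lying in
the domain of `Λ_Q^r`. -/
structure IsSymmKernel (q : ι → ℝ) (r : ℝ) {n : ℕ} (c : (Fin n → ι) → X) : Prop where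
  symm : ∀ (σ : Equiv.Perm (Fin n)) (i : Fin n → ι), c (i ∘ σ) = c i
  memℓp : Memℓp c 2
  mem_domain : Memℓp (fun i => tensorWeight q r i • c i) 2

lemma memℓp_map {κ : Type*} {f : κ → X} (hf : Memℓp f 2) (L : X →L[ℝ] Y) :
    Memℓp (fun i => L (f i)) 2 :=
  (lp.mapCLM 2 (fun _ : κ => L) (norm_nonneg L) (fun _ => le_rfl) ⟨f, hf⟩).2

lemma integral_smul_add {a : Ω → ℝ} (ha : MemLp a 2 P) (x y : Lp X 2 P) :
    ∫ ω, a ω • (x + y) ω ∂P = ∫ ω, a ω • x ω ∂P + ∫ ω, a ω • y ω ∂P := by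
  have int : ∀ x : Lp X 2 P, Integrable (fun ω => a ω • x ω) P := fun x =>
    memLp_one_iff_integrable.1 ((Lp.memLp x).smul ha)
  rw [← integral_add (int x) (int y)]
  refine integral_congr_ae ?_
  filter_upwards [Lp.coeFn_add x y] with ω hω
  rw [hω, Pi.add_apply, smul_add]

lemma integral_smul_map [CompleteSpace X] [CompleteSpace Y] {a : Ω → ℝ} (ha : MemLp a 2 P)
    (x : Lp X 2 P) (L : X →L[ℝ] Y) :
    ∫ ω, a ω • (L.compLpL 2 P x) ω ∂P = L (∫ ω, a ω • x ω ∂P) := by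
  have int : Integrable (fun ω => a ω • x ω) P :=
    memLp_one_iff_integrable.1 ((Lp.memLp x).smul ha)
  rw [← L.integral_comp_comm int]
  refine integral_congr_ae ?_
  filter_upwards [L.coeFn_compLpL x] with ω hω
  rw [hω, map_smul]

variable {P W u}

lemma IsSkorokhod.add {f f' : ι → Lp X 2 P} {g g' : Lp X 2 P}
    (h : IsSkorokhod P W u f g) (h' : IsSkorokhod P W u f' g') :
    IsSkorokhod P W u (f + f') (g + g') := by
  refine ⟨h.1.add h'.1, fun φ G hG => ?_⟩
  have := (h.2 φ G hG).add (h'.2 φ G hG)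
  rw [integral_smul_add P (Lp.memLp φ)]
  simpa only [Pi.add_apply, integral_smul_add P ((Lp.memLp G).const_inner _)] using this

lemma IsSkorokhod.map [CompleteSpace X] [CompleteSpace Y] {f : ι → Lp X 2 P} {g : Lp X 2 P}
    (h : IsSkorokhod P W u f g) (L : X →L[ℝ] Y) :
    IsSkorokhod P W u (fun k => L.compLpL 2 P (f k)) (L.compLpL 2 P g) := by
  refine ⟨?_, fun φ G hG => ?_⟩
  · exact (lp.mapCLM 2 (fun _ : ι => L.compLpL 2 P) (norm_nonneg _) (fun _ => le_rfl)
      ⟨f, h.1⟩).2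
  · have := (h.2 φ G hG).mapL L
    rw [integral_smul_map P (Lp.memLp φ)]
    simpa only [integral_smul_map P ((Lp.memLp G).const_inner _)] using this

lemma IsSkorokhod.zero : IsSkorokhod P W u (0 : ι → Lp X 2 P) 0 := by
  have key : ∀ a : Ω → ℝ, ∫ ω, a ω • (0 : Lp X 2 P) ω ∂P = 0 := by
    intro a
    refine integral_eq_zero_of_ae ?_
    filter_upwards [Lp.coeFn_zero X 2 P] with ω hω
    rw [hω]
    simp
  refine ⟨zero_memℓp, fun φ G hG => ?_⟩
  simp only [Pi.zero_apply, key]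
  exact hasSum_zero

lemma IsIteratedSkorokhod.add {n : ℕ} {f f' : (Fin n → ι) → Lp X 2 P} {g g' : Lp X 2 P}
    (h : IsIteratedSkorokhod P W u n f g) (h' : IsIteratedSkorokhod P W u n f' g') :
    IsIteratedSkorokhod P W u n (f + f') (g + g') := by
  induction n generalizing g g' with
  | zero =>
    simp only [IsIteratedSkorokhod] at h h' ⊢
    rw [h, h', Pi.add_apply]
  | succ n ih =>
    obtain ⟨hf, k, hk, hs, hi⟩ := h
    obtain ⟨hf', k', hk', hs', hi'⟩ := h'
    exact ⟨hf.add hf', k + k', hk.add hk', fun j => (hs j).add (hs' j), ih hi hi'⟩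

lemma IsIteratedSkorokhod.map [CompleteSpace X] [CompleteSpace Y] {n : ℕ}
    {f : (Fin n → ι) → Lp X 2 P} {g : Lp X 2 P}
    (h : IsIteratedSkorokhod P W u n f g) (L : X →L[ℝ] Y) :
    IsIteratedSkorokhod P W u n (fun i => L.compLpL 2 P (f i)) (L.compLpL 2 P g) := by
  have mem : ∀ {κ : Type _} {f : κ → Lp X 2 P}, Memℓp f 2 →
      Memℓp (fun i => L.compLpL 2 P (f i)) 2 := fun {κ f} hf =>
    (lp.mapCLM 2 (fun _ : κ => L.compLpL 2 P) (norm_nonneg _) (fun _ => le_rfl) ⟨f, hf⟩).2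
  induction n generalizing g with
  | zero =>
    simp only [IsIteratedSkorokhod] at h ⊢
    rw [h]
  | succ n ih =>
    obtain ⟨hf, k, hk, hs, hi⟩ := h
    exact ⟨mem hf, _, mem hk, fun j => (hs j).map L, ih hi⟩

lemma IsIteratedSkorokhod.zero {n : ℕ} :
    IsIteratedSkorokhod P W u n (0 : (Fin n → ι) → Lp X 2 P) 0 := by
  induction n with
  | zero => simp [IsIteratedSkorokhod]
  | succ n ih => exact ⟨zero_memℓp, 0, zero_memℓp, fun j => IsSkorokhod.zero, ih⟩

end Skorokhod

section Space

variable {Ω U ι : Type*} [MeasurableSpace Ω]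
  [NormedAddCommGroup U] [InnerProductSpace ℝ U]
  (P : Measure Ω) [IsProbabilityMeasure P] (W : U → Ω → ℝ) (u : HilbertBasis ι ℝ U)
  (q : ι → ℝ) (r : ℝ)
  (X : Type*) [NormedAddCommGroup X] [InnerProductSpace ℝ X] [CompleteSpace X]

/-- The random elements `η = ∑ₙ (1/n!) δⁿ(ηₙ)` (finite sums, with `δ⁰(η₀) = η₀`) whose
kernels `ηₙ ∈ X ⊗ U^{⊗̂ n}` lie in the domain of `Λ_Q^r`. An element is recorded as the random
element `η` together with its kernels `(ηₙ)ₙ`. -/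
def chaosSubmodule : Submodule ℝ (Lp X 2 P × ((n : ℕ) → (Fin n → ι) → X)) where
  carrier := {p | {n | p.2 n ≠ 0}.Finite ∧ (∀ n, IsSymmKernel q r (p.2 n)) ∧
    ∃ I : ℕ →₀ Lp X 2 P,
      (∀ n, IsIteratedSkorokhod P W u n (fun i => Lp.const 2 P (p.2 n i)) (I n)) ∧
      p.1 = I.sum fun n g => (1 / (n.factorial : ℝ)) • g}
  zero_mem' := by
    refine ⟨by simp, fun n => ⟨fun _ _ => rfl, zero_memℓp, ?_⟩, 0, fun n => ?_, by simp⟩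
    · simpa [Pi.zero_def] using (zero_memℓp : Memℓp (0 : (Fin n → ι) → X) 2)
    · simpa [Pi.zero_def] using (IsIteratedSkorokhod.zero : IsIteratedSkorokhod P W u n 0 (0 : Lp X 2 P))
  add_mem' := by
    rintro a b ⟨ha, ha', I, hI, hIa⟩ ⟨hb, hb', J, hJ, hJb⟩
    refine ⟨(ha.union hb).subset fun n hn => ?_, fun n => ⟨fun σ i => ?_, ?_, ?_⟩, I + J,
      fun n => ?_, ?_⟩
    · by_contra h
      simp only [Set.mem_union, Set.mem_ofPred_eq, not_or, not_not] at h
      exact hn (by simp [h.1, h.2])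
    · simp [(ha' n).symm σ i, (hb' n).symm σ i]
    · exact (ha' n).memℓp.add (hb' n).memℓp
    · simpa [Pi.add_def] using (ha' n).mem_domain.add (hb' n).mem_domain
    · simpa [Pi.add_def] using (hI n).add (hJ n)
    · rw [Finsupp.sum_add_index' (by simp) (by simp), ← hIa, ← hJb]
      rfl
  smul_mem' := by
    rintro c a ⟨ha, ha', I, hI, hIa⟩
    refine ⟨ha.subset fun n hn h => hn (by simp [h]), fun n => ⟨fun σ i => ?_, ?_, ?_⟩, c • I,
      fun n => ?_, ?_⟩
    · simp [(ha' n).symm σ i]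
    · exact (ha' n).memℓp.const_smul c
    · simpa [Pi.smul_def, smul_comm c] using (ha' n).mem_domain.const_smul c
    · have h := (hI n).map (c • ContinuousLinearMap.id ℝ X)
      have e : ∀ g : Lp X 2 P, (c • ContinuousLinearMap.id ℝ X).compLpL 2 P g = c • g := by
        intro g
        refine Lp.ext ?_
        filter_upwards [(c • ContinuousLinearMap.id ℝ X).coeFn_compLpL g,
          Lp.coeFn_smul c g] with ω h1 h2
        simp [h1, h2]
      simp only [e] at h
      exact h
    · rw [Finsupp.sum_smul_index' (by simp), Prod.smul_fst, hIa, Finsupp.smul_sum]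
      exact Finsupp.sum_congr fun n _ => smul_comm _ _ _

/-- The pre-Hilbert space whose completion is `(L)_{Q,r}`: the random elements of
`chaosSubmodule`, normed by `‖η‖² = ∑ₙ (1/n!)² ‖Λ_Q^r ηₙ‖²`. -/
def ChaosSpace : Type _ := chaosSubmodule P W u q r X

namespace ChaosSpace

instance : AddCommGroup (ChaosSpace P W u q r X) :=
  inferInstanceAs (AddCommGroup (chaosSubmodule P W u q r X))

instance : Module ℝ (ChaosSpace P W u q r X) :=
  inferInstanceAs (Module ℝ (chaosSubmodule P W u q r X))

variable {P W u q r X}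

/-- The random element. -/
def rv (η : ChaosSpace P W u q r X) : Lp X 2 P := η.1.1

/-- The kernels `ηₙ`. -/
def kernel (η : ChaosSpace P W u q r X) : (n : ℕ) → (Fin n → ι) → X := η.1.2

lemma memℓp_coord (η : ChaosSpace P W u q r X) :
    Memℓp (fun s : Σ n : ℕ, (Fin n → ι) =>
      (1 / (s.1.factorial : ℝ)) • tensorWeight q r s.2 • η.kernel s.1 s.2) 2 := by
  obtain ⟨hfin, hker, -⟩ := η.2
  refine memℓp_gen ?_
  rw [summable_sigma_of_nonneg (fun _ => by positivity)]
  refine ⟨fun n => ?_, summable_of_hasFiniteSupport (hfin.subset fun n hn h => hn ?_)⟩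
  · exact (memℓp_gen_iff (by simp)).1 ((hker n).mem_domain.const_smul (1 / (n.factorial : ℝ)))
  · have h' : η.kernel n = 0 := h
    simp [h']

variable (P W u q r X) in
/-- The coordinates of `((1/n!) Λ_Q^r ηₙ)ₙ` in `⨁ₙ X ⊗ U^{⊗ n}`. -/
def coord : ChaosSpace P W u q r X →ₗ[ℝ] lp (fun _ : Σ n : ℕ, (Fin n → ι) => X) 2 where
  toFun η := ⟨_, η.memℓp_coord⟩
  map_add' η θ := by
    ext s
    have : (η + θ).kernel s.1 s.2 = η.kernel s.1 s.2 + θ.kernel s.1 s.2 := rfl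
    change _ = (1 / (s.1.factorial : ℝ)) • tensorWeight q r s.2 • η.kernel s.1 s.2 +
      (1 / (s.1.factorial : ℝ)) • tensorWeight q r s.2 • θ.kernel s.1 s.2
    simp only [this, smul_add]
  map_smul' c η := by
    ext s
    have : (c • η).kernel s.1 s.2 = c • η.kernel s.1 s.2 := rfl
    change _ = c • (1 / (s.1.factorial : ℝ)) • tensorWeight q r s.2 • η.kernel s.1 s.2
    simp only [this, smul_comm c]

instance : SeminormedAddCommGroup (ChaosSpace P W u q r X) :=
  SeminormedAddCommGroup.induced _ _ (coord P W u q r X)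

instance : NormedSpace ℝ (ChaosSpace P W u q r X) :=
  NormedSpace.induced ℝ _ _ (coord P W u q r X)

lemma norm_sq_eq (η : ChaosSpace P W u q r X) :
    ‖η‖ ^ 2 = ∑' n : ℕ, (1 / (n.factorial : ℝ) ^ 2) *
      ∑' i : Fin n → ι, ‖tensorWeight q r i • η.kernel n i‖ ^ 2 := by
  have h1 : ‖η‖ = ‖coord P W u q r X η‖ := rfl
  have h2 := lp.norm_rpow_eq_tsum (p := 2) (by simp) (coord P W u q r X η)
  have h3 := (memℓp_gen_iff (p := 2) (by simp)).1 (coord P W u q r X η).2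
  simp only [ENNReal.toReal_ofNat, Real.rpow_ofNat] at h2 h3
  rw [h1, h2, h3.tsum_sigma]
  refine tsum_congr fun n => ?_
  rw [← tsum_mul_left]
  refine tsum_congr fun i => ?_
  change ‖(1 / (n.factorial : ℝ)) • tensorWeight q r i • η.kernel n i‖ ^ 2 = _
  rw [norm_smul, mul_pow]
  simp

variable {Y : Type*} [NormedAddCommGroup Y] [InnerProductSpace ℝ Y] [CompleteSpace Y]

lemma map_mem (L : X →L[ℝ] Y) (η : ChaosSpace P W u q r X) :
    (L.compLpL 2 P η.rv, fun n i => L (η.kernel n i)) ∈ chaosSubmodule P W u q r Y := by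
  obtain ⟨hfin, hker, I, hI, hIη⟩ := η.2
  refine ⟨hfin.subset fun n hn h => hn ?_, fun n => ⟨fun σ i => ?_, ?_, ?_⟩,
    I.mapRange (L.compLpL 2 P) (map_zero _), fun n => ?_, ?_⟩
  · have h' : η.kernel n = 0 := h
    funext i
    simp [h']
  · exact congrArg L ((hker n).symm σ i)
  · exact memℓp_map (hker n).memℓp L
  · have h := memℓp_map (hker n).mem_domain L
    simp only [map_smul] at h
    exact h
  · have h := (hI n).map L
    have e : ∀ x : X, L.compLpL 2 P (Lp.const 2 P x) = Lp.const 2 P (L x) := by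
      intro x
      refine Lp.ext ?_
      filter_upwards [L.coeFn_compLpL (Lp.const 2 P x), Lp.coeFn_const 2 P x,
        Lp.coeFn_const 2 P (L x)] with ω h1 h2 h3
      rw [h1, h2, h3]
      rfl
    simp only [e] at h
    exact h
  · have h' : η.rv = I.sum fun n g => (1 / (n.factorial : ℝ)) • g := hIη
    simp only [h']
    rw [Finsupp.sum_mapRange_index (by simp), map_finsuppSum]
    simp only [map_smul]

/-- `η ↦ L η` for a bounded operator `L : X → Y`, on random elements and kernels alike. -/
def map (L : X →L[ℝ] Y) : ChaosSpace P W u q r X →L[ℝ] ChaosSpace P W u q r Y :=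
  LinearMap.mkContinuous
    { toFun := fun η => ⟨_, map_mem L η⟩
      map_add' := fun η θ => Subtype.ext <| Prod.ext (map_add (L.compLpL 2 P) η.rv θ.rv) <|
        funext fun n => funext fun i => map_add L (η.kernel n i) (θ.kernel n i)
      map_smul' := fun c η => Subtype.ext <| Prod.ext (map_smul (L.compLpL 2 P) c η.rv) <|
        funext fun n => funext fun i => map_smul L c (η.kernel n i) }
    ‖L‖ fun η => by
      let T := lp.mapCLM 2 (fun _ : Σ n : ℕ, (Fin n → ι) => L) (norm_nonneg L) fun _ => le_rfl
      have h : coord P W u q r Y ⟨_, map_mem L η⟩ = T (coord P W u q r X η) := by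
        ext s
        change (1 / (s.1.factorial : ℝ)) • tensorWeight q r s.2 • L (η.kernel s.1 s.2) =
          L ((1 / (s.1.factorial : ℝ)) • tensorWeight q r s.2 • η.kernel s.1 s.2)
        simp
      change ‖coord P W u q r Y ⟨_, map_mem L η⟩‖ ≤ ‖L‖ * ‖coord P W u q r X η‖
      rw [h]
      exact T.le_of_opNorm_le (lp.norm_mapCLM_le _ _ _ _) _

lemma norm_map_le (L : X →L[ℝ] Y) :
    ‖(map L : ChaosSpace P W u q r X →L[ℝ] ChaosSpace P W u q r Y)‖ ≤ ‖L‖ :=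
  LinearMap.mkContinuous_norm_le _ (norm_nonneg L) _

lemma map_add (L M : X →L[ℝ] Y) (η : ChaosSpace P W u q r X) :
    map (L + M) η = map L η + map M η :=
  Subtype.ext <| Prod.ext (ContinuousLinearMap.add_compLp L M η.rv) rfl

lemma map_smul (c : ℝ) (L : X →L[ℝ] Y) (η : ChaosSpace P W u q r X) :
    map (c • L) η = c • map L η :=
  Subtype.ext <| Prod.ext (ContinuousLinearMap.smul_compLp c L η.rv) rfl

end ChaosSpace

/-- The space `(L)_{Q,r}(F; X)`. -/
abbrev LSpace : Type _ := UniformSpace.Completion (ChaosSpace P W u q r X)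

/-- The dual space `(L)^{Q,r}(F)` of `(L)_{Q,r}(F) = (L)_{Q,r}(F; ℝ)`. -/
abbrev LDual : Type _ := StrongDual ℝ (LSpace P W u q r ℝ)

variable {P W u q r X}

/-- The coefficient `η_α ∈ X` of `η ∈ (L)_{Q,r}(F; X)` at `ξ_α`: the continuous extension of
`η ↦ E (η ξ_α)`. -/
def LSpace.coeff (α : ι →₀ ℕ) : LSpace P W u q r X → X :=
  UniformSpace.Completion.extension fun η : ChaosSpace P W u q r X =>
    ∫ ω, xi W u α ω • η.rv ω ∂P

/-- The formal series `∑_α ζ_α ξ_α` is the functional `ℓ` in the dual relative to the inner product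
of `L₂(F)`: the pairing of every `ξ_α` with `ℓ` is `ζ_α`, the value of `E (ξ_α ∑_β ζ_β ξ_β)`. -/
def IsFormalSeries (ζ : (ι →₀ ℕ) → ℝ) (ℓ : LDual P W u q r) : Prop :=
  ∀ α, ∃ e : ChaosSpace P W u q r ℝ, e.rv =ᵐ[P] xi W u α ∧
    ℓ (e : LSpace P W u q r ℝ) = ζ α

/-- The formal series `∑_α ζ_α ξ_α` is an element of `(L)^{Q,r}(F)`. -/
def MemLDual (P : Measure Ω) [IsProbabilityMeasure P] (W : U → Ω → ℝ) (u : HilbertBasis ι ℝ U)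
    (q : ι → ℝ) (r : ℝ) (ζ : (ι →₀ ℕ) → ℝ) : Prop :=
  ∃ ℓ : LDual P W u q r, IsFormalSeries ζ ℓ

/-- `(x, η)_X ∈ (L)_{Q,r}(F)` for `η ∈ (L)_{Q,r}(F; X)`. -/
def LSpace.inner (x : X) : LSpace P W u q r X →L[ℝ] LSpace P W u q r ℝ :=
  (ChaosSpace.map (innerSL ℝ x)).completion

@[simp] lemma LSpace.inner_coe (x : X) (η : ChaosSpace P W u q r X) :
    LSpace.inner x (η : LSpace P W u q r X) =
      (ChaosSpace.map (innerSL ℝ x) η : ChaosSpace P W u q r ℝ) :=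
  ContinuousLinearMap.completion_apply_coe _ _

lemma LSpace.inner_add (x y : X) (η : LSpace P W u q r X) :
    LSpace.inner (x + y) η = LSpace.inner x η + LSpace.inner y η := by
  induction η using UniformSpace.Completion.induction_on with
  | hp =>
    exact isClosed_eq (LSpace.inner (x + y)).continuous
      ((LSpace.inner x).continuous.add (LSpace.inner y).continuous)
  | ih η =>
    simp only [LSpace.inner_coe, ← UniformSpace.Completion.coe_add, _root_.map_add,
      ChaosSpace.map_add]

lemma LSpace.inner_smul (c : ℝ) (x : X) (η : LSpace P W u q r X) :
    LSpace.inner (c • x) η = c • LSpace.inner x η := by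
  induction η using UniformSpace.Completion.induction_on with
  | hp =>
    exact isClosed_eq (LSpace.inner (c • x)).continuous
      ((LSpace.inner x).continuous.const_smul c)
  | ih η =>
    have h : innerSL ℝ (c • x) = c • innerSL ℝ x := by ext; simp
    simp only [LSpace.inner_coe, ← UniformSpace.Completion.coe_smul, h, ChaosSpace.map_smul]

lemma LSpace.norm_inner_le (x : X) (η : LSpace P W u q r X) :
    ‖LSpace.inner x η‖ ≤ ‖x‖ * ‖η‖ := by
  induction η using UniformSpace.Completion.induction_on with
  | hp => exact isClosed_le (by fun_prop) (by fun_prop)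
  | ih η =>
    rw [LSpace.inner_coe, UniformSpace.Completion.norm_coe, UniformSpace.Completion.norm_coe]
    exact (ChaosSpace.map (innerSL ℝ x)).le_of_opNorm_le
      ((ChaosSpace.norm_map_le _).trans (innerSL_apply_norm (𝕜 := ℝ) x).le) η

/-- The duality `⟪⟪η, ℓ⟫⟫ ∈ X` between `η ∈ (L)_{Q,r}(F; X)` and `ℓ ∈ (L)^{Q,r}(F)`: the element
of `X` with `(x, ⟪⟪η, ℓ⟫⟫)_X = ℓ ((x, η)_X)` for all `x ∈ X`. -/
def pairing (η : LSpace P W u q r X) (ℓ : LDual P W u q r) : X :=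
  (InnerProductSpace.toDual ℝ X).symm <| LinearMap.mkContinuous
    { toFun := fun x => ℓ (LSpace.inner x η)
      map_add' := fun x y => by rw [LSpace.inner_add, map_add]
      map_smul' := fun c x => by rw [LSpace.inner_smul, map_smul, RingHom.id_apply] }
    (‖ℓ‖ * ‖η‖) fun x => (ℓ.le_opNorm_of_le (LSpace.norm_inner_le x η)).trans_eq (by ring)

lemma inner_pairing (x : X) (η : LSpace P W u q r X) (ℓ : LDual P W u q r) :
    ⟪x, pairing η ℓ⟫_ℝ = ℓ (LSpace.inner x η) := by
  rw [real_inner_comm, pairing, InnerProductSpace.toDual_symm_apply]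
  rfl

/-- For `X = ℝ` the duality is evaluation of the functional. -/
lemma pairing_real (η : LSpace P W u q r ℝ) (ℓ : LDual P W u q r) : pairing η ℓ = ℓ η := by
  have h1 : ∀ η : LSpace P W u q r ℝ, LSpace.inner (1 : ℝ) η = η := by
    intro η
    induction η using UniformSpace.Completion.induction_on with
    | hp =>
      exact isClosed_eq (LSpace.inner (1 : ℝ)).continuous continuous_id
    | ih η =>
      rw [LSpace.inner_coe]
      congr 1
      refine Subtype.ext (Prod.ext ?_ ?_)
      · refine Lp.ext ?_
        filter_upwards [(innerSL ℝ (1 : ℝ)).coeFn_compLpL η.rv] with ω h1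
        exact h1.trans (by simp [ChaosSpace.rv])
      · funext n i
        change ⟪(1 : ℝ), η.kernel n i⟫_ℝ = η.kernel n i
        simp
  have h := inner_pairing (1 : ℝ) η ℓ
  rw [h1] at h
  simpa using h

end Space

end WhiteNoise

end

/-! In the chaos coordinates, $(\mathcal L)_{Q,r}$ is a weighted $\ell_2$ space in which the
$\xi_\alpha$ are orthogonal with $\|\xi_\alpha\|^2 = q^{2r\alpha}/|\alpha|!$. Its dual is therefore
the $\ell_2$ space with the reciprocal weight $|\alpha|!\,q^{-2r\alpha}$, called `dualWeight`.

The norm is defined through iterated Skorokhod integrals, so the work lies in linking it to the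
$\xi_\alpha$. Put $w_\alpha = \xi_\alpha/\sqrt{\alpha!}$ (`wick`). Gaussian integration by parts in
the direction $u_k$ gives $E(w_\alpha\,(u_k, D\varphi)) = (\alpha_k+1)\,E(w_{\alpha+e_k}\varphi)$
(`integral_wick_mul_inner`). Read as a Skorokhod integral, this shows that $|\alpha|!\,w_\alpha$ is
the $|\alpha|$-fold integral of the indicator of the tuples whose occurrence count is $\alpha$
(`isIteratedSkorokhod_wick`). Tested against $w_\alpha$, an iterated integral reveals the sum of its
kernel over those same tuples (`ChaosSpace.integral_wick_smul_rv`). Kernels are symmetric, so they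
are recovered from the random element (`ChaosSpace.kernel_eq`). The norm sees only the kernels,
hence functionals depend on the random element alone and finite combinations of the $w_\alpha$ are
dense (`ChaosSpace.hasSum_wick`).

If the weighted series of $\zeta$ converges, Cauchy-Schwarz bounds
$\sum\|\zeta_\alpha\eta_\alpha\|_X$ by a multiple of $\|\eta\|$ (`LSpace.sum_norm_smul_coeff_le`).
The series is thus absolutely convergent even in $X$, and for $X=\mathbb R$ it defines the
functional. Conversely, a bounded functional is tested on $\sum_{\alpha\in
S}|\alpha|!\,q^{-2r\alpha}\zeta_\alpha\xi_\alpha$ (`IsFormalSeries.summable`). The $X$-valued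
formula follows by pairing with each $x\in X$. -/

noncomputable section

namespace WhiteNoise

/-! ### Hermite polynomials and the Gaussian density -/

section Hermite

open Polynomial in
lemma derivative_hermite_succ (n : ℕ) :
    derivative (hermite (n + 1)) = ((n : ℤ[X]) + 1) * hermite n := by
  induction n with
  | zero => simp
  | succ n ih =>
    have h : derivative (derivative (hermite (n + 1))) =
        ((n : ℤ[X]) + 1) * derivative (hermite n) := by
      rw [ih]; simp
    rw [hermite_succ (n + 1), derivative_sub, derivative_mul, h, derivative_X, ih,
      hermite_succ n]
    push_cast
    ring

/-- The normalized Hermite polynomial `Hₙ / n!`. -/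
def normHermite (n : ℕ) (x : ℝ) : ℝ :=
  Polynomial.aeval x (Polynomial.hermite n) / (n.factorial : ℝ)

@[simp] lemma normHermite_zero (x : ℝ) : normHermite 0 x = 1 := by simp [normHermite]

/-- The normalization by $n!$, rather than $\sqrt{n!}$, is chosen so that differentiation is a pure
shift; integer factors then appear only on the integration side. -/
lemma hasDerivAt_normHermite_succ (n : ℕ) (x : ℝ) :
    HasDerivAt (normHermite (n + 1)) (normHermite n x) x := by
  have h := ((Polynomial.hermite (n + 1)).hasDerivAt_aeval x).div_const ((n + 1).factorial : ℝ)
  refine h.congr_deriv ?_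
  rw [derivative_hermite_succ, normHermite, map_mul, Nat.factorial_succ]
  have : (n.factorial : ℝ) ≠ 0 := by positivity
  simp
  field_simp

lemma hasDerivAt_gaussianPDFReal (x : ℝ) :
    HasDerivAt (gaussianPDFReal 0 1) (-x * gaussianPDFReal 0 1 x) x := by
  have h : HasDerivAt (fun x : ℝ => -(x - 0) ^ 2 / (2 * ((1 : NNReal) : ℝ))) (-x) x := by
    have := (((hasDerivAt_id x).sub_const 0).pow 2).neg.div_const (2 * ((1 : NNReal) : ℝ))
    refine this.congr_deriv ?_
    simp
    ring
  have := h.exp.const_mul (√(2 * Real.pi * ((1 : NNReal) : ℝ)))⁻¹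
  rw [gaussianPDFReal_def]
  refine this.congr_deriv ?_
  ring

/-- This is the Hermite recurrence $H_{n+1} = xH_n - H_n'$ in differentiated Rodrigues form. The
factor $n+1$ comes from $n!$ versus $(n+1)!$. -/
lemma hasDerivAt_gaussianPDFReal_mul_normHermite (n : ℕ) (x : ℝ) :
    HasDerivAt (fun x => gaussianPDFReal 0 1 x * normHermite n x)
      (-((n + 1 : ℝ) * (gaussianPDFReal 0 1 x * normHermite (n + 1) x))) x := by
  have h := (hasDerivAt_gaussianPDFReal x).mul
    (((Polynomial.hermite n).hasDerivAt_aeval x).div_const (n.factorial : ℝ))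
  refine h.congr_deriv ?_
  have : (n.factorial : ℝ) ≠ 0 := by positivity
  simp only [normHermite, Polynomial.hermite_succ, map_sub, map_mul, Polynomial.aeval_X,
    Nat.factorial_succ]
  push_cast
  field_simp
  ring

lemma normHermite_hasTemperateGrowth (n : ℕ) : (normHermite n).HasTemperateGrowth := by
  have h (p : Polynomial ℤ) :
      (fun x : ℝ => Polynomial.aeval x p).HasTemperateGrowth := by
    induction p using Polynomial.induction_on' with
    | add p q hp hq => simpa [Pi.add_def] using hp.add hq
    | monomial n a =>
      simp only [Polynomial.aeval_monomial]
      fun_prop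
  have := (h (Polynomial.hermite n)).mul
    (Function.HasTemperateGrowth.const (E := ℝ) ((n.factorial : ℝ)⁻¹))
  exact this

end Hermite

/-! ### Random variables with all moments, and one-dimensional integration by parts -/

section Moments

variable {Ω : Type*} [MeasurableSpace Ω] {μ : Measure Ω}
  {E F : Type*} [NormedAddCommGroup E] [NormedAddCommGroup F]

/-- `f` is strongly measurable with moments of all finite orders. -/
def HasMoments (f : Ω → E) (μ : Measure Ω) : Prop := ∀ p : ℝ≥0∞, p ≠ ∞ → MemLp f p μ

lemma HasMoments.memLp_two {f : Ω → E} (hf : HasMoments f μ) : MemLp f 2 μ := hf 2 (by simp)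

lemma HasMoments.integrable {f : Ω → E} (hf : HasMoments f μ) : Integrable f μ :=
  memLp_one_iff_integrable.1 (hf 1 (by simp))

/-- Hölder with exponents $2p, 2p$: having all finite moments is stable under products, whereas
membership in a fixed $L_p$ is not. -/
lemma HasMoments.smul [NormedSpace ℝ E] {f : Ω → ℝ} {g : Ω → E} (hf : HasMoments f μ) (hg : HasMoments g μ) :
    HasMoments (fun ω => f ω • g ω) μ := by
  intro p hp
  have h2 : p * 2 ≠ ∞ := ENNReal.mul_ne_top hp (by simp)
  have : ENNReal.HolderTriple (p * 2) (p * 2) p := ⟨by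
    rw [ENNReal.mul_inv (by simp) (by simp), ← mul_add, ENNReal.inv_two_add_inv_two, mul_one]⟩
  exact (hg _ h2).smul (hf _ h2)

lemma HasMoments.mul {f g : Ω → ℝ} (hf : HasMoments f μ) (hg : HasMoments g μ) :
    HasMoments (fun ω => f ω * g ω) μ := hf.smul hg

lemma HasMoments.const [IsFiniteMeasure μ] (c : E) : HasMoments (fun _ => c) μ :=
  fun _ _ => memLp_const c

lemma HasMoments.add {f g : Ω → E} (hf : HasMoments f μ) (hg : HasMoments g μ) :
    HasMoments (fun ω => f ω + g ω) μ := fun p hp => (hf p hp).add (hg p hp)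

lemma HasMoments.pow [IsFiniteMeasure μ] {f : Ω → ℝ} (hf : HasMoments f μ) (n : ℕ) :
    HasMoments (fun ω => f ω ^ n) μ := by
  induction n with
  | zero => simpa using HasMoments.const (μ := μ) (1 : ℝ)
  | succ n ih => simpa only [pow_succ] using ih.mul hf

lemma HasMoments.prod [IsFiniteMeasure μ] {κ : Type*} (s : Finset κ) {f : κ → Ω → ℝ}
    (hf : ∀ k ∈ s, HasMoments (f k) μ) : HasMoments (fun ω => ∏ k ∈ s, f k ω) μ := by
  classical
  induction s using Finset.induction_on with
  | empty => simpa using HasMoments.const (μ := μ) (1 : ℝ)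
  | insert a s ha ih =>
    simp only [Finset.prod_insert ha]
    exact (hf a (by simp)).mul (ih fun k hk => hf k (by simp [hk]))

lemma HasMoments.of_polynomial_growth [IsFiniteMeasure μ] {f : Ω → E} (hf : HasMoments f μ)
    {g : E → F} (hg : Continuous g) {n : ℕ} {C : ℝ} (h : ∀ x, ‖g x‖ ≤ C * (1 + ‖x‖) ^ n) :
    HasMoments (fun ω => g (f ω)) μ := by
  intro p hp
  have hn : HasMoments (fun ω => ‖f ω‖) μ := fun p hp => (hf p hp).norm
  refine (((HasMoments.const C).mul (((HasMoments.const 1).add hn).pow n)) p hp).mono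
    (hg.comp_aestronglyMeasurable (hf 1 (by simp)).1) (Filter.Eventually.of_forall fun ω => ?_)
  exact (h (f ω)).trans (Real.le_norm_self _)

lemma HasMoments.comp_temperate [NormedSpace ℝ E] [NormedSpace ℝ F] [IsFiniteMeasure μ]
    {f : Ω → E} (hf : HasMoments f μ)
    {g : E → F} (hg : g.HasTemperateGrowth) : HasMoments (fun ω => g (f ω)) μ := by
  obtain ⟨n, C, h⟩ := hg.2 0
  exact hf.of_polynomial_growth hg.1.continuous (by simpa using h)

lemma HasMoments.comp_fderiv [NormedSpace ℝ E] [NormedSpace ℝ F] [IsFiniteMeasure μ]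
    {f : Ω → E} (hf : HasMoments f μ)
    {g : E → F} (hg : g.HasTemperateGrowth) (a : E) :
    HasMoments (fun ω => fderiv ℝ g (f ω) a) μ := by
  obtain ⟨n, C, h⟩ := hg.2 1
  simp only [norm_iteratedFDeriv_one] at h
  refine hf.of_polynomial_growth (g := fun x => fderiv ℝ g x a) (n := n) (C := C * ‖a‖)
    ((hg.1.continuous_fderiv (by simp)).clm_apply continuous_const) fun x => ?_
  calc _ ≤ ‖fderiv ℝ g x‖ * ‖a‖ := (fderiv ℝ g x).le_opNorm a
    _ ≤ C * (1 + ‖x‖) ^ n * ‖a‖ := by gcongr; exact h x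
    _ = _ := by ring

lemma hasMoments_id_gaussianReal (m : ℝ) (v : NNReal) :
    HasMoments (fun x : ℝ => x) (gaussianReal m v) := fun p hp => memLp_id_gaussianReal' p hp

/-- Gaussian integration by parts against Hermite polynomials. -/
lemma integral_normHermite_mul_deriv {g : ℝ → ℝ} (hg : g.HasTemperateGrowth) (n : ℕ) :
    ∫ x, normHermite n x * deriv g x ∂(gaussianReal 0 1) =
      (n + 1) * ∫ x, normHermite (n + 1) x * g x ∂(gaussianReal 0 1) := by
  have hX := hasMoments_id_gaussianReal 0 1
  have hint {f : ℝ → ℝ} (hf : HasMoments f (gaussianReal 0 1)) :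
      Integrable (fun x => gaussianPDFReal 0 1 x * f x) := by
    have := hf.integrable
    rw [gaussianReal_of_var_ne_zero _ one_ne_zero, gaussianPDF_def,
      integrable_withDensity_iff_integrable_smul₀' (by fun_prop) (by simp)] at this
    refine this.congr (Filter.Eventually.of_forall fun x => ?_)
    simp [ENNReal.toReal_ofReal (gaussianPDFReal_nonneg _ _ _)]
  have hH (n : ℕ) : HasMoments (normHermite n) (gaussianReal 0 1) :=
    hX.comp_temperate (normHermite_hasTemperateGrowth n)
  have hgm : HasMoments g (gaussianReal 0 1) := hX.comp_temperate hg
  have hdm : HasMoments (deriv g) (gaussianReal 0 1) := by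
    simpa only [fderiv_apply_one_eq_deriv] using hX.comp_fderiv hg 1
  have hd : ∀ x, HasDerivAt g (deriv g x) x := fun x =>
    (hg.1.differentiable (by simp) x).hasDerivAt
  -- Integrability of the product itself makes the boundary terms at $\pm\infty$ vanish.
  have key := integral_mul_deriv_eq_deriv_mul_of_integrable
    (fun x _ => hasDerivAt_gaussianPDFReal_mul_normHermite n x) (fun x _ => hd x)
    ?_ ?_ ?_
  · simp only [integral_gaussianReal_eq_integral_smul (one_ne_zero), smul_eq_mul]
    rw [← integral_const_mul]
    simp only [neg_mul, integral_neg, neg_neg] at key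
    simpa only [mul_assoc] using key
  · simpa only [mul_assoc, Pi.mul_def] using hint ((hH n).mul hdm)
  · refine ((hint ((hH (n + 1)).mul hgm)).const_mul (-(n + 1 : ℝ))).congr
      (Filter.Eventually.of_forall fun x => ?_)
    simp only [Pi.mul_apply]
    ring
  · simpa only [mul_assoc, Pi.mul_def] using hint ((hH n).mul hgm)

end Moments

/-! ### Integration by parts for the white noise -/

section IntegrationByParts

set_option linter.unusedSectionVars false

variable {Ω U ι : Type*} [MeasurableSpace Ω]
  [NormedAddCommGroup U] [InnerProductSpace ℝ U]
  {P : Measure Ω} [IsProbabilityMeasure P] {W : U → Ω → ℝ}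

lemma IsWhiteNoise.hasMoments (hW : IsWhiteNoise P W) (h : U) : HasMoments (W h) P :=
  fun _ hp => (hW.gaussian.hasGaussianLaw_eval h).memLp hp

lemma IsWhiteNoise.hasMoments_pi (hW : IsWhiteNoise P W) {N : ℕ} (h : Fin N → U) :
    HasMoments (fun ω i => W (h i) ω) P := by
  intro p hp
  let L : ({x // x ∈ (Finset.univ : Finset (Fin N))} → ℝ) →L[ℝ] (Fin N → ℝ) :=
    ContinuousLinearMap.pi fun i => ContinuousLinearMap.proj ⟨i, Finset.mem_univ i⟩
  exact (((hW.gaussian.comp_right h).hasGaussianLaw Finset.univ).map L).memLp hp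

lemma IsWhiteNoise.map_eq_gaussianReal (hW : IsWhiteNoise P W) {e : U} (he : ‖e‖ = 1) :
    P.map (W e) = gaussianReal 0 1 := by
  rw [(hW.gaussian.hasGaussianLaw_eval e).map_eq_gaussianReal,
    variance_eq_sub (hW.hasMoments e).memLp_two, hW.mean_zero]
  have : ∫ ω, W e ω ^ 2 ∂P = 1 := by
    simpa [sq, he] using hW.covariance e e
  simp [this]

/-- The part of the noise orthogonal to the unit vector `e` is independent of `W e`. -/
lemma IsWhiteNoise.indepFun_sub_inner (hW : IsWhiteNoise P W) {e : U} (he : ‖e‖ = 1) :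
    IndepFun (W e) (fun ω h => W h ω - ⟪e, h⟫_ℝ * W e ω) P := by
  classical
  -- Placing `W e` and the residual noise in one jointly Gaussian process reduces independence to
  -- vanishing covariance.
  have hG : IsGaussianProcess
      (Sum.elim (fun _ : Unit => W e) fun h ω => W h ω - ⟪e, h⟫_ℝ * W e ω) P := by
    refine hW.gaussian.of_isGaussianProcess fun s => ?_
    cases s with
    | inl s => exact ⟨{e}, ContinuousLinearMap.proj ⟨e, by simp⟩, fun ω => rfl⟩
    | inr h =>
      exact ⟨{e, h}, ContinuousLinearMap.proj ⟨h, by simp⟩ -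
        ⟪e, h⟫_ℝ • ContinuousLinearMap.proj ⟨e, by simp⟩, fun ω => by simp⟩
  have key := hG.indepFun_of_covariance_eq_zero (fun _ => (hW.measurable e).aemeasurable)
    (fun h => ((hW.measurable h).sub ((hW.measurable e).const_mul _)).aemeasurable) ?_
  · exact key.comp (φ := fun x : Unit → ℝ => x ()) (ψ := id) (by fun_prop) measurable_id
  · intro _ h
    have m1 := hW.hasMoments e
    have m2 := hW.hasMoments h
    have m3 : MemLp (fun ω => W h ω - ⟪e, h⟫_ℝ * W e ω) 2 P :=
      m2.memLp_two.sub (m1.memLp_two.const_mul _)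
    rw [covariance_eq_sub m1.memLp_two m3, hW.mean_zero, zero_mul, sub_zero]
    have i1 := (m1.mul m2).integrable
    have i2 := ((m1.mul m1).integrable).const_mul ⟪e, h⟫_ℝ
    calc ∫ ω, (W e * fun ω => W h ω - ⟪e, h⟫_ℝ * W e ω) ω ∂P
        = ∫ ω, (W e ω * W h ω - ⟪e, h⟫_ℝ * (W e ω * W e ω)) ∂P := by
          refine integral_congr_ae (Filter.Eventually.of_forall fun ω => ?_)
          simp only [Pi.mul_apply]; ring
      _ = 0 := by
          rw [integral_sub i1 i2, integral_const_mul, hW.covariance, hW.covariance]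
          simp [he]

variable (W) (u : HilbertBasis ι ℝ U)

/-- The variable `∏ₖ H_{αₖ}(W(uₖ)) / αₖ!`, that is, `ξ_α / √(α!)`. -/
def wick (α : ι →₀ ℕ) (ω : Ω) : ℝ := α.prod fun k n => normHermite n (W (u k) ω)

variable {W}

@[simp] lemma wick_zero (ω : Ω) : wick W u 0 ω = 1 := by simp [wick]

lemma hasMoments_wick (hW : IsWhiteNoise P W) (α : ι →₀ ℕ) : HasMoments (wick W u α) P :=
  HasMoments.prod _ fun k _ =>
    (hW.hasMoments (u k)).comp_temperate (normHermite_hasTemperateGrowth _)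

/-- `α! = ∏ₖ αₖ!` -/
def multiFactorial (α : ι →₀ ℕ) : ℝ := α.prod fun _ n => (n.factorial : ℝ)

lemma multiFactorial_pos (α : ι →₀ ℕ) : 0 < multiFactorial α :=
  Finset.prod_pos fun _ _ => by positivity

lemma xi_eq (α : ι →₀ ℕ) (ω : Ω) : xi W u α ω = √(multiFactorial α) * wick W u α ω := by
  rw [multiFactorial, Finsupp.prod, Real.sqrt_eq_rpow,
    ← Real.finsetProd_rpow _ _ fun _ _ => by positivity, xi, wick, Finsupp.prod, Finsupp.prod,
    ← Finset.prod_mul_distrib]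
  refine Finset.prod_congr rfl fun k _ => ?_
  rw [← Real.sqrt_eq_rpow, normHermite]
  have h : (0 : ℝ) < (α k).factorial := by positivity
  have h2 := Real.sq_sqrt h.le
  have h3 : √((α k).factorial : ℝ) ≠ 0 := (Real.sqrt_pos.2 h).ne'
  field_simp
  rw [h2]

/-- Integration by parts in the direction `uₖ` on smooth cylindrical variables. -/
lemma integral_wick_mul_fderiv (hW : IsWhiteNoise P W) (α : ι →₀ ℕ) (k : ι) {N : ℕ}
    (h : Fin N → U) {F : (Fin N → ℝ) → ℝ} (hF : F.HasTemperateGrowth) :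
    ∫ ω, wick W u α ω * fderiv ℝ F (fun i => W (h i) ω) (fun i => ⟪u k, h i⟫_ℝ) ∂P =
      (α k + 1) * ∫ ω, wick W u (α + Finsupp.single k 1) ω * F (fun i => W (h i) ω) ∂P := by
  classical
  have he : ‖u k‖ = 1 := u.orthonormal.1 k
  set a : Fin N → ℝ := fun i => ⟪u k, h i⟫_ℝ with ha
  -- `Y` is the noise with its `u k` component removed, independent of `W (u k)`. Fubini for the
  -- product law then isolates a one-dimensional Gaussian integral.
  set Y : Ω → U → ℝ := fun ω h => W h ω - ⟪u k, h⟫_ℝ * W (u k) ω with hY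
  have hYm : Measurable Y := measurable_pi_lambda _ fun h =>
    (hW.measurable h).sub ((hW.measurable (u k)).const_mul _)
  have hind : P.map (fun ω => (W (u k) ω, Y ω)) = (gaussianReal 0 1).prod (P.map Y) := by
    rw [← hW.map_eq_gaussianReal he]
    exact (indepFun_iff_map_prod_eq_prod_map_map (hW.measurable _).aemeasurable
      hYm.aemeasurable).1 (hW.indepFun_sub_inner he)
  -- The factors of `wick` at indices other than `k` see only `Y`, by orthogonality of the basis.
  set R : (U → ℝ) → ℝ := fun y => (α.erase k).prod fun j n => normHermite n (y (u j)) with hR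
  have hH (n : ℕ) : Continuous (normHermite n) := (normHermite_hasTemperateGrowth n).1.continuous
  have hRm : Measurable R :=
    Finset.measurable_prod _ fun j _ => (hH _).measurable.comp (measurable_pi_apply _)
  have hRY (ω : Ω) : R (Y ω) = (α.erase k).prod fun j n => normHermite n (W (u j) ω) := by
    refine Finset.prod_congr rfl fun j hj => ?_
    have hjk : k ≠ j := by rintro rfl; simp at hj
    simp [hY, u.orthonormal.2 hjk]
  have hw1 (ω : Ω) : wick W u α ω = normHermite (α k) (W (u k) ω) * R (Y ω) := by
    rw [hRY, wick, ← Finsupp.mul_prod_erase' α k _ (by simp)]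
  have hw2 (ω : Ω) : wick W u (α + Finsupp.single k 1) ω =
      normHermite (α k + 1) (W (u k) ω) * R (Y ω) := by
    rw [hRY, wick, ← Finsupp.mul_prod_erase' _ k _ (by simp)]
    simp [Finsupp.erase_add]
  -- This rebuilds the arguments of `F` from the two independent parts. For fixed second component
  -- it is an affine line in direction `a`, along which the derivative of `F` is the required
  -- directional one.
  set pt : ℝ × (U → ℝ) → Fin N → ℝ := fun z i => z.1 * a i + z.2 (h i) with hpt
  have hptm : Measurable pt := by fun_prop
  have hptY (ω : Ω) : pt (W (u k) ω, Y ω) = fun i => W (h i) ω := by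
    ext i; simp only [hpt, ha, hY]; ring
  set Φ : ℝ × (U → ℝ) → ℝ := fun z => normHermite (α k) z.1 * R z.2 * fderiv ℝ F (pt z) a with hΦ
  set Ψ : ℝ × (U → ℝ) → ℝ := fun z => normHermite (α k + 1) z.1 * R z.2 * F (pt z) with hΨ
  have hΦm : Measurable Φ :=
    (((hH _).measurable.comp measurable_fst).mul (hRm.comp measurable_snd)).mul
      ((((hF.1.continuous_fderiv (by simp)).clm_apply continuous_const).measurable).comp hptm)
  have hΨm : Measurable Ψ :=
    (((hH _).measurable.comp measurable_fst).mul (hRm.comp measurable_snd)).mul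
      (hF.1.continuous.measurable.comp hptm)
  have hZ : Measurable fun ω => (W (u k) ω, Y ω) := (hW.measurable _).prodMk hYm
  have transfer {f : ℝ × (U → ℝ) → ℝ} (hf : Measurable f)
      (hint : Integrable (fun ω => f (W (u k) ω, Y ω)) P) :
      ∫ ω, f (W (u k) ω, Y ω) ∂P = ∫ y, ∫ x, f (x, y) ∂(gaussianReal 0 1) ∂(P.map Y) := by
    have : IsProbabilityMeasure (P.map Y) := Measure.isProbabilityMeasure_map hYm.aemeasurable
    rw [← integral_map hZ.aemeasurable hf.aestronglyMeasurable, hind, integral_prod_symm]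
    rw [← hind]
    exact (integrable_map_measure hf.aestronglyMeasurable hZ.aemeasurable).2 hint
  have e1 (ω : Ω) : wick W u α ω * fderiv ℝ F (fun i => W (h i) ω) a = Φ (W (u k) ω, Y ω) := by
    simp only [hΦ, hptY, hw1]
  have e2 (ω : Ω) : wick W u (α + Finsupp.single k 1) ω * F (fun i => W (h i) ω) =
      Ψ (W (u k) ω, Y ω) := by
    simp only [hΨ, hptY, hw2]
  have i1 := ((hasMoments_wick u hW α).mul ((hW.hasMoments_pi h).comp_fderiv hF a)).integrable
  have i2 := ((hasMoments_wick u hW (α + Finsupp.single k 1)).mul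
    ((hW.hasMoments_pi h).comp_temperate hF)).integrable
  simp only [e1] at i1 ⊢
  simp only [e2] at i2 ⊢
  rw [transfer hΦm i1, transfer hΨm i2, ← integral_const_mul]
  refine integral_congr_ae (Filter.Eventually.of_forall fun y => ?_)
  have hpty : (fun x : ℝ => pt (x, y)) = fun x => x • a + fun i => y (h i) := by
    ext x i; simp [hpt]
  have hg : (fun x : ℝ => F (pt (x, y))).HasTemperateGrowth := by
    refine hF.comp (f := fun x => pt (x, y)) ?_
    rw [hpty]
    exact ((Function.HasTemperateGrowth.id').smul (.const a)).add (.const _)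
  have hd (x : ℝ) : deriv (fun x : ℝ => F (pt (x, y))) x = fderiv ℝ F (pt (x, y)) a := by
    have h1 : HasDerivAt (fun x : ℝ => pt (x, y)) a x := by
      rw [hpty]
      simpa using ((hasDerivAt_id x).smul_const a).add_const (fun i => y (h i))
    exact ((hF.1.differentiable (by simp) (pt (x, y))).hasFDerivAt.comp_hasDerivAt x h1).deriv
  have key := congrArg (fun t => R y * t) (integral_normHermite_mul_deriv hg (α k))
  simp only [hd] at key
  simp only [hΦ, hΨ]
  calc _ = R y * ∫ x, normHermite (α k) x * fderiv ℝ F (pt (x, y)) a ∂(gaussianReal 0 1) := by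
        rw [← integral_const_mul]; congr 1; ext x; ring
    _ = _ := key
    _ = _ := by
        rw [mul_left_comm, ← integral_const_mul]; congr 2; ext x; ring

/-- The variable `∏ₖ H_{αₖ}(W(uₖ)) / αₖ!` as an element of `L₂`. -/
def wickLp (hW : IsWhiteNoise P W) (α : ι →₀ ℕ) : Lp ℝ 2 P :=
  (hasMoments_wick u hW α).memLp_two.toLp _

lemma coeFn_wickLp (hW : IsWhiteNoise P W) (α : ι →₀ ℕ) :
    wickLp u hW α =ᵐ[P] wick W u α := MemLp.coeFn_toLp _

/-- `∏ₖ H_{αₖ}(W(uₖ)) / αₖ! · uₖ` has Skorokhod integral given by raising `αₖ`. -/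
lemma integral_wick_mul_inner (hW : IsWhiteNoise P W) (α : ι →₀ ℕ) (k : ι)
    {φ : Lp ℝ 2 P} {G : Lp U 2 P} (hG : HasMalliavinDeriv P W φ G) :
    ∫ ω, wick W u α ω * ⟪u k, G ω⟫_ℝ ∂P =
      (α k + 1) * ∫ ω, wick W u (α + Finsupp.single k 1) ω * φ ω ∂P := by
  have hl (β : ι →₀ ℕ) (ψ : Lp ℝ 2 P) :
      ∫ ω, wick W u β ω * ψ ω ∂P = ⟪ψ, wickLp u hW β⟫_ℝ := by
    rw [L2.inner_def]
    refine integral_congr_ae ?_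
    filter_upwards [coeFn_wickLp u hW β] with ω h1
    simp [h1]
  have hr (G : Lp U 2 P) : ∫ ω, wick W u α ω * ⟪u k, G ω⟫_ℝ ∂P =
      ⟪(innerSL ℝ (u k)).compLpL 2 P G, wickLp u hW α⟫_ℝ := by
    rw [← hl]
    refine integral_congr_ae ?_
    filter_upwards [(innerSL ℝ (u k)).coeFn_compLpL G] with ω h1
    simp [h1]
  rw [hr, hl]
  -- Both sides are continuous in $(\varphi, G)$, so the identity passes from smooth cylindrical
  -- variables to their closure.
  refine closure_minimal (t := {p : Lp ℝ 2 P × Lp U 2 P |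
    ⟪(innerSL ℝ (u k)).compLpL 2 P p.2, wickLp u hW α⟫_ℝ =
      (α k + 1) * ⟪p.1, wickLp u hW (α + Finsupp.single k 1)⟫_ℝ}) ?_
    (isClosed_eq (by fun_prop) (by fun_prop)) hG
  rintro ⟨φ, G⟩ ⟨N, h, F, hF, hφ, hG⟩
  simp only [Set.mem_ofPred_eq]
  rw [← hr, ← hl]
  have := integral_wick_mul_fderiv u hW α k h hF
  convert this using 1
  · refine integral_congr_ae ?_
    filter_upwards [hG] with ω h1
    have h1 : G ω = _ := h1
    rw [h1, inner_sum]
    congr 1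
    conv_rhs => rw [pi_eq_sum_univ' (fun i => ⟪u k, h i⟫_ℝ)]
    simp only [map_sum, map_smul, inner_smul_right, smul_eq_mul]
    refine Finset.sum_congr rfl fun i _ => ?_
    rw [mul_comm]
  · congr 1
    refine integral_congr_ae ?_
    filter_upwards [hφ] with ω h1
    have h1 : φ ω = _ := h1
    rw [h1]

/-- This makes the `wick` variables available as test functions in the definition of the Skorokhod
integral. The case `α k = 0` is separate because truncated subtraction would return `α` there
instead of a zero derivative. -/
lemma exists_hasMalliavinDeriv_wick (hW : IsWhiteNoise P W) (α : ι →₀ ℕ) :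
    ∃ G : Lp U 2 P, HasMalliavinDeriv P W (wickLp u hW α) G ∧ ∀ k, ∀ᵐ ω ∂P,
      ⟪u k, G ω⟫_ℝ = if α k = 0 then 0 else wick W u (α - Finsupp.single k 1) ω := by
  classical
  have hG2 : MemLp (fun ω => ∑ k ∈ α.support, wick W u (α - Finsupp.single k 1) ω • u k) 2 P :=
    memLp_finsetSum _ fun k _ => (((hasMoments_wick u hW _).smul (.const (u k))).memLp_two)
  refine ⟨hG2.toLp _, subset_closure ?_, fun k => ?_⟩
  · let e := α.support.equivFin.symm
    let F : (Fin α.support.card → ℝ) → ℝ := fun x => ∏ i, normHermite (α (e i)) (x i)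
    have hfac (i : Fin α.support.card) :
        (fun x : Fin α.support.card → ℝ => normHermite (α (e i)) (x i)).HasTemperateGrowth :=
      (normHermite_hasTemperateGrowth _).comp
        (ContinuousLinearMap.proj (R := ℝ) (φ := fun _ => ℝ) i).hasTemperateGrowth
    have hF : F.HasTemperateGrowth := by
      have : ∀ s : Finset (Fin α.support.card),
          (fun x : Fin α.support.card → ℝ =>
            ∏ i ∈ s, normHermite (α (e i)) (x i)).HasTemperateGrowth := by
        intro s
        induction s using Finset.induction_on with
        | empty => simp
        | insert a s ha ih =>
          simp only [Finset.prod_insert ha]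
          exact (hfac a).mul ih
      exact this _
    have hsum (f : ι → U) :
        ∑ k ∈ α.support, f k = ∑ i, f (e i) := by
      rw [← Finset.sum_coe_sort, ← e.sum_comp]
    have hprod (f : ι → ℝ) : ∏ k ∈ α.support, f k = ∏ i, f (e i) := by
      rw [← Finset.prod_coe_sort, ← e.prod_comp]
    refine ⟨α.support.card, fun i => u (e i), F, hF, ?_, ?_⟩
    · filter_upwards [coeFn_wickLp u hW α] with ω h1
      have h1 : wickLp u hW α ω = _ := h1
      simp only [h1, wick, Finsupp.prod, F, hprod]
    · filter_upwards [hG2.coeFn_toLp] with ω h1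
      refine h1.trans ((hsum _).trans ?_)
      refine Finset.sum_congr rfl fun i _ => ?_
      congr 1
      set x : Fin α.support.card → ℝ := fun j => W (u (e j)) ω
      have hd : HasFDerivAt F _ x := HasFDerivAt.finsetProd (u := Finset.univ)
        fun j _ => ((hfac j).1.differentiable (by simp) x).hasFDerivAt
      have hp (j : Fin α.support.card) :
          fderiv ℝ (fun x : Fin α.support.card → ℝ => normHermite (α (e j)) (x j)) x
            (Pi.single i 1) = if j = i then normHermite (α (e i) - 1) (x i) else 0 := by
        have hne : α (e j) ≠ 0 := Finsupp.mem_support_iff.1 (e j).2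
        obtain ⟨n, hn⟩ := Nat.exists_eq_succ_of_ne_zero hne
        have h2 := (hasDerivAt_normHermite_succ n (x j)).comp_hasFDerivAt x
          (ContinuousLinearMap.proj (R := ℝ) (φ := fun _ => ℝ) j).hasFDerivAt
        have h3 : fderiv ℝ (fun x : Fin α.support.card → ℝ => normHermite (α (e j)) (x j)) x =
            normHermite n (x j) •
              ContinuousLinearMap.proj (R := ℝ) (φ := fun _ : Fin α.support.card => ℝ) j := by
          rw [hn]; exact h2.fderiv
        rw [h3]
        by_cases hji : j = i
        · subst hji
          simp [hn]
        · simp [hji]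
      -- In the product rule along the `i`-th axis only the `i`-th factor has a non-zero derivative.
      rw [hd.fderiv, _root_.sum_apply,
        Finset.sum_eq_single i (fun j _ hj => by
          rw [_root_.smul_apply, hp, if_neg hj, smul_zero]) (by simp),
        _root_.smul_apply, hp, if_pos rfl, smul_eq_mul, mul_comm,
        wick, ← Finsupp.mul_prod_erase' _ (e i : ι) _ (by simp)]
      have h0 : (α - Finsupp.single (e i : ι) 1 : ι →₀ ℕ) (e i) = α (e i) - 1 := by simp
      have h2 : (α - Finsupp.single (e i : ι) 1 : ι →₀ ℕ).erase (e i : ι) = α.erase (e i : ι) := by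
        ext j
        by_cases hj : j = e i
        · simp [hj]
        · simp [Finsupp.erase_ne hj, Ne.symm hj]
      rw [h0, h2]
      congr 1
      rw [Finsupp.prod, Finsupp.support_erase]
      refine Finset.prod_bij' (fun k hk => e.symm ⟨k, Finset.mem_of_mem_erase hk⟩)
        (fun j _ => (e j : ι)) ?_ ?_ ?_ ?_ ?_
      · intro k hk
        simp only [Finset.mem_erase, Finset.mem_univ, and_true]
        intro hc
        refine (Finset.mem_erase.1 hk).1 ?_
        rw [← hc]
        simp
      · intro j hj
        refine Finset.mem_erase.2 ⟨fun hc => (Finset.mem_erase.1 hj).1 ?_, (e j).2⟩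
        exact e.injective (Subtype.ext hc)
      · intro k hk; simp
      · intro j hj; simp
      · intro k hk
        simp [x, Finsupp.erase_ne (Finset.mem_erase.1 hk).1]
  · filter_upwards [hG2.coeFn_toLp] with ω h1
    rw [h1, inner_sum]
    simp only [inner_smul_right, orthonormal_iff_ite.1 u.orthonormal]
    simp

end IntegrationByParts

/-! ### Tuples of indices and their multi-indices -/

section Occupation

variable {ι : Type*}

/-- The multi-index counting the occurrences of each index in a tuple. -/
def occ {n : ℕ} (i : Fin n → ι) : ι →₀ ℕ := ∑ j, Finsupp.single (i j) 1

lemma occ_elim0 (i : Fin 0 → ι) : occ i = 0 := by simp [occ]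

lemma occ_cons {n : ℕ} (k : ι) (j : Fin n → ι) :
    occ (Fin.cons k j : Fin (n + 1) → ι) = Finsupp.single k 1 + occ j := by
  simp [occ, Fin.sum_univ_succ]

lemma occ_comp_perm {n : ℕ} (σ : Equiv.Perm (Fin n)) (i : Fin n → ι) : occ (i ∘ σ) = occ i :=
  Equiv.sum_comp σ fun j => Finsupp.single (i j) 1

lemma degree_occ {n : ℕ} (i : Fin n → ι) : (occ i).degree = n := by
  simp [occ, map_sum]

lemma occ_apply {n : ℕ} (i : Fin n → ι) (k : ι) [DecidablePred fun j => i j = k] :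
    occ i k = Fintype.card {j // i j = k} := by
  classical
  simp [occ, Finsupp.finsetSum_apply, Finsupp.single_apply, Fintype.card_subtype]

lemma mem_support_of_occ_le {n : ℕ} {i : Fin n → ι} {α : ι →₀ ℕ} (h : occ i ≤ α) (j : Fin n) :
    i j ∈ α.support := by
  classical
  rw [Finsupp.mem_support_iff]
  have h1 := h (i j)
  have h2 : 0 < occ i (i j) := by
    rw [occ_apply]
    exact Fintype.card_pos_iff.2 ⟨⟨j, rfl⟩⟩
  omega

/-- Tuples with the same occurrences are permutations of each other. -/
lemma exists_perm_of_occ_eq {n : ℕ} {i j : Fin n → ι} (h : occ i = occ j) :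
    ∃ σ : Equiv.Perm (Fin n), j ∘ σ = i := by
  classical
  -- The positions where `i` and `j` take the value `k` are equally many; gluing bijections over all
  -- `k` gives the permutation.
  have e (k : ι) : {a // i a = k} ≃ {a // j a = k} :=
    Fintype.equivOfCardEq (by rw [← occ_apply, ← occ_apply, h])
  refine ⟨(Equiv.sigmaFiberEquiv i).symm.trans
    ((Equiv.sigmaCongrRight e).trans (Equiv.sigmaFiberEquiv j)), ?_⟩
  ext a
  exact (e (i a) ⟨a, rfl⟩).2

open Classical in
/-- The tuples of all lengths with occurrences `α`. -/
def fiber (α : ι →₀ ℕ) : Finset (Σ n : ℕ, (Fin n → ι)) :=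
  ((Fintype.piFinset fun _ : Fin α.degree => α.support).filter (occ · = α)).map
    ⟨Sigma.mk α.degree, sigma_mk_injective⟩

lemma mem_fiber {α : ι →₀ ℕ} {s : Σ n : ℕ, (Fin n → ι)} : s ∈ fiber α ↔ occ s.2 = α := by
  classical
  simp only [fiber, Finset.mem_map, Finset.mem_filter, Fintype.mem_piFinset,
    Function.Embedding.coeFn_mk]
  constructor
  · rintro ⟨i, ⟨-, hi⟩, rfl⟩
    exact hi
  · rintro rfl
    obtain ⟨n, i⟩ := s
    have := degree_occ i
    dsimp only
    rw [this]
    exact ⟨i, ⟨mem_support_of_occ_le le_rfl, rfl⟩, rfl⟩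

lemma fst_of_mem_fiber {α : ι →₀ ℕ} {s : Σ n : ℕ, (Fin n → ι)} (hs : s ∈ fiber α) :
    s.1 = α.degree := by
  rw [← mem_fiber.1 hs, degree_occ]

lemma occ_cons_le_iff {n : ℕ} {k : ι} {j : Fin n → ι} {α : ι →₀ ℕ} :
    occ (Fin.cons k j : Fin (n + 1) → ι) ≤ α ↔ occ j ≤ α ∧ (α - occ j) k ≠ 0 := by
  classical
  rw [occ_cons]
  constructor
  · intro h
    refine ⟨le_trans (by simp) h, ?_⟩
    have := h k
    simp only [Finsupp.add_apply, Finsupp.single_eq_same] at this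
    rw [Finsupp.tsub_apply]
    omega
  · rintro ⟨h1, h2⟩ l
    have := h1 l
    by_cases hl : k = l
    · subst hl
      rw [Finsupp.tsub_apply] at h2
      simp only [Finsupp.add_apply, Finsupp.single_eq_same]
      omega
    · simpa [Finsupp.single_apply, hl] using this

lemma tsub_occ_cons {n : ℕ} (k : ι) (j : Fin n → ι) (α : ι →₀ ℕ) :
    α - occ (Fin.cons k j : Fin (n + 1) → ι) = α - occ j - Finsupp.single k 1 := by
  rw [occ_cons, add_comm, tsub_add_eq_tsub_tsub]

lemma finite_occ_le (n : ℕ) (α : ι →₀ ℕ) : {i : Fin n → ι | occ i ≤ α}.Finite := by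
  classical
  refine (Fintype.piFinset fun _ : Fin n => α.support).finite_toSet.subset fun i hi => ?_
  rw [Finset.mem_coe, Fintype.mem_piFinset]
  exact mem_support_of_occ_le hi

lemma memℓp_of_finite_support {κ X : Type*} [NormedAddCommGroup X] {f : κ → X}
    (hf : (Function.support f).Finite) : Memℓp f 2 :=
  (memℓp_zero hf).of_exponent_ge zero_le

end Occupation

/-! ### Skorokhod integrals tested against, and producing, Hermite variables -/

section Duality

set_option linter.unusedSectionVars false

variable {Ω U ι X : Type*} [MeasurableSpace Ω]
  [NormedAddCommGroup U] [InnerProductSpace ℝ U]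
  [NormedAddCommGroup X] [InnerProductSpace ℝ X] [CompleteSpace X]
  {P : Measure Ω} [IsProbabilityMeasure P] {W : U → Ω → ℝ} (u : HilbertBasis ι ℝ U)

/-- Integration by parts against the constant `1 = wick 0`, whose Malliavin derivative vanishes. -/
lemma integral_wick_succ (hW : IsWhiteNoise P W) (α : ι →₀ ℕ) (k : ι) :
    ∫ ω, wick W u (α + Finsupp.single k 1) ω ∂P = 0 := by
  obtain ⟨G, hG, hG'⟩ := exists_hasMalliavinDeriv_wick u hW 0
  have h := integral_wick_mul_inner u hW α k hG
  have h1 : ∫ ω, wick W u α ω * ⟪u k, G ω⟫_ℝ ∂P = 0 := by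
    refine integral_eq_zero_of_ae ?_
    filter_upwards [hG' k] with ω h1
    simp [h1]
  have h2 : ∫ ω, wick W u (α + Finsupp.single k 1) ω * wickLp u hW 0 ω ∂P =
      ∫ ω, wick W u (α + Finsupp.single k 1) ω ∂P := by
    refine integral_congr_ae ?_
    filter_upwards [coeFn_wickLp u hW 0] with ω h1
    simp [h1]
  rw [h1, h2, eq_comm, mul_eq_zero] at h
  exact h.resolve_left (by positivity)

lemma eq_add_single_of_ne_zero {α : ι →₀ ℕ} {k : ι} (h : α k ≠ 0) :
    α = α - Finsupp.single k 1 + Finsupp.single k 1 :=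
  (tsub_add_cancel_of_le (Finsupp.single_le_iff.2 (Nat.one_le_iff_ne_zero.2 h))).symm

open Classical in
lemma integral_wick (hW : IsWhiteNoise P W) (α : ι →₀ ℕ) :
    ∫ ω, wick W u α ω ∂P = if α = 0 then 1 else 0 := by
  split_ifs with h
  · simp [h]
  · obtain ⟨k, hk⟩ := Finsupp.ne_iff.1 h
    rw [eq_add_single_of_ne_zero hk]
    exact integral_wick_succ u hW _ k

lemma multiFactorial_add_single (α : ι →₀ ℕ) (k : ι) :
    multiFactorial (α + Finsupp.single k 1) = (α k + 1) * multiFactorial α := by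
  classical
  rw [multiFactorial, multiFactorial, ← Finsupp.mul_prod_erase' _ k _ (by simp),
    ← Finsupp.mul_prod_erase' α k _ (by simp)]
  simp [Finsupp.erase_add, Nat.factorial_succ]
  ring

/-- Integrating by parts moves one unit of `α` off one factor and lowers the other by
differentiation, at the cost of dividing by $\alpha_k$. Induction on $|\alpha|$ collects
$1/\alpha!$. -/
lemma integral_wick_mul_self (hW : IsWhiteNoise P W) (α : ι →₀ ℕ) :
    ∫ ω, wick W u α ω * wick W u α ω ∂P = (multiFactorial α)⁻¹ := by
  obtain ⟨n, hn⟩ : ∃ n, α.degree = n := ⟨_, rfl⟩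
  induction n generalizing α with
  | zero =>
    obtain rfl := (Finsupp.degree_eq_zero_iff α).1 hn
    simp [multiFactorial]
  | succ n ih =>
    have h0 : α ≠ 0 := by rintro rfl; simp at hn
    obtain ⟨k, hk⟩ := Finsupp.ne_iff.1 h0
    obtain ⟨β, rfl⟩ : ∃ β, α = β + Finsupp.single k 1 := ⟨_, eq_add_single_of_ne_zero hk⟩
    obtain ⟨G, hG, hG'⟩ := exists_hasMalliavinDeriv_wick u hW (β + Finsupp.single k 1)
    have h := integral_wick_mul_inner u hW β k hG
    have h1 : ∫ ω, wick W u β ω * ⟪u k, G ω⟫_ℝ ∂P = (multiFactorial β)⁻¹ := by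
      rw [← ih β (by simp at hn; omega)]
      refine integral_congr_ae ?_
      filter_upwards [hG' k] with ω h1
      simp [h1]
    have h2 : ∫ ω, wick W u (β + Finsupp.single k 1) ω *
        wickLp u hW (β + Finsupp.single k 1) ω ∂P =
        ∫ ω, wick W u (β + Finsupp.single k 1) ω * wick W u (β + Finsupp.single k 1) ω ∂P := by
      refine integral_congr_ae ?_
      filter_upwards [coeFn_wickLp u hW (β + Finsupp.single k 1)] with ω h1
      simp [h1]
    rw [h1, h2] at h
    have h3 : (β k + 1 : ℝ) ≠ 0 := by positivity
    rw [multiFactorial_add_single, mul_inv, h, ← mul_assoc, inv_mul_cancel₀ h3, one_mul]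

-- Duality with the test variable `wick α`: differentiating lowers one entry, so only indices in the
-- support contribute. The larger set `s` lets the iteration keep one fixed index set while the
-- multi-index shrinks.
open Classical in
lemma IsSkorokhod.integral_wick_smul (hW : IsWhiteNoise P W) {f : ι → Lp X 2 P} {g : Lp X 2 P}
    (h : IsSkorokhod P W u f g) (α : ι →₀ ℕ) {s : Finset ι} (hs : α.support ⊆ s) :
    ∫ ω, wick W u α ω • g ω ∂P = ∑ k ∈ s,
      if α k = 0 then 0 else ∫ ω, wick W u (α - Finsupp.single k 1) ω • f k ω ∂P := by
  obtain ⟨G, hG, hG'⟩ := exists_hasMalliavinDeriv_wick u hW α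
  have h1 := h.2 _ _ hG
  have h2 : ∫ ω, wickLp u hW α ω • g ω ∂P = ∫ ω, wick W u α ω • g ω ∂P := by
    refine integral_congr_ae ?_
    filter_upwards [coeFn_wickLp u hW α] with ω h1
    rw [h1]
  have h3 (k : ι) : ∫ ω, ⟪u k, G ω⟫_ℝ • f k ω ∂P =
      if α k = 0 then 0 else ∫ ω, wick W u (α - Finsupp.single k 1) ω • f k ω ∂P := by
    split_ifs with hk
    · refine integral_eq_zero_of_ae ?_
      filter_upwards [hG' k] with ω h1
      simp [h1, hk]
    · refine integral_congr_ae ?_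
      filter_upwards [hG' k] with ω h1
      rw [h1, if_neg hk]
  simp only [h2, h3] at h1
  refine h1.unique (hasSum_sum_of_ne_finset_zero fun k hk => if_pos ?_)
  by_contra hc
  exact hk (hs (Finsupp.mem_support_iff.2 hc))

open Classical in
lemma IsIteratedSkorokhod.integral_wick_smul (hW : IsWhiteNoise P W) {n : ℕ}
    {f : (Fin n → ι) → Lp X 2 P} {g : Lp X 2 P}
    (h : IsIteratedSkorokhod P W u n f g) (α : ι →₀ ℕ) :
    ∫ ω, wick W u α ω • g ω ∂P = ∑ i ∈ Fintype.piFinset fun _ : Fin n => α.support,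
      if occ i ≤ α then ∫ ω, wick W u (α - occ i) ω • f i ω ∂P else 0 := by
  induction n generalizing g with
  | zero =>
    have hg : g = f Fin.elim0 := h
    have : (Fintype.piFinset fun _ : Fin 0 => α.support) = {Fin.elim0} := by
      ext i; simp [eq_iff_true_of_subsingleton]
    rw [this, Finset.sum_singleton, occ_elim0, if_pos (zero_le), tsub_zero, hg]
  | succ n ih =>
    obtain ⟨-, k, -, hs, hi⟩ := h
    rw [ih hi]
    have step (j : Fin n → ι) : (if occ j ≤ α then ∫ ω, wick W u (α - occ j) ω • k j ω ∂P else 0) =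
        ∑ l ∈ α.support, if occ (Fin.cons l j : Fin (n + 1) → ι) ≤ α then
          ∫ ω, wick W u (α - occ (Fin.cons l j : Fin (n + 1) → ι)) ω •
            f (Fin.cons l j) ω ∂P else 0 := by
      split_ifs with hj
      · rw [(hs j).integral_wick_smul u hW _ (s := α.support)
          (Finsupp.support_mono tsub_le_self)]
        refine Finset.sum_congr rfl fun l _ => ?_
        simp only [occ_cons_le_iff, hj, true_and, tsub_occ_cons, ne_eq, ite_not]
      · refine (Finset.sum_eq_zero fun l _ => if_neg fun hc => hj (occ_cons_le_iff.1 hc).1).symm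
    simp only [step]
    rw [← Finset.sum_product']
    refine Finset.sum_nbij' (fun p => (Fin.cons p.2 p.1 : Fin (n + 1) → ι))
      (fun i => (Fin.tail i, i 0)) ?_ ?_ ?_ ?_ ?_
    · rintro ⟨j, l⟩ hp
      simp only [Finset.mem_product, Fintype.mem_piFinset] at hp ⊢
      intro m
      refine Fin.cases ?_ (fun m => ?_) m
      · simpa using hp.2
      · simpa using hp.1 m
    · intro i hi
      simp only [Finset.mem_product, Fintype.mem_piFinset] at hi ⊢
      exact ⟨fun m => hi _, hi _⟩
    · rintro ⟨j, l⟩ _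
      simp
    · intro i _
      simp
    · rintro ⟨j, l⟩ _
      rfl

-- For a deterministic kernel the remaining expectation of `wick` is zero unless the multi-index has
-- been used up exactly.
open Classical in
lemma IsIteratedSkorokhod.integral_wick_smul_const (hW : IsWhiteNoise P W) {n : ℕ}
    {c : (Fin n → ι) → X} {g : Lp X 2 P}
    (h : IsIteratedSkorokhod P W u n (fun i => Lp.const 2 P (c i)) g) (α : ι →₀ ℕ) :
    ∫ ω, wick W u α ω • g ω ∂P = ∑ i ∈ Fintype.piFinset fun _ : Fin n => α.support,
      if occ i = α then c i else 0 := by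
  rw [h.integral_wick_smul u hW]
  refine Finset.sum_congr rfl fun i _ => ?_
  have hc : ∫ ω, wick W u (α - occ i) ω • Lp.const 2 P (c i) ω ∂P =
      (∫ ω, wick W u (α - occ i) ω ∂P) • c i := by
    rw [← integral_smul_const]
    refine integral_congr_ae ?_
    filter_upwards [Lp.coeFn_const 2 P (c i)] with ω h1
    rw [h1, Function.const_apply]
  rw [hc, integral_wick u hW]
  by_cases h1 : occ i ≤ α
  · have : α - occ i = 0 ↔ occ i = α := by
      rw [tsub_eq_zero_iff_le]
      exact ⟨fun h2 => le_antisymm h1 h2, fun h2 => h2.ge⟩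
    simp only [h1, if_true, this]
    split_ifs <;> simp
  · rw [if_neg h1, if_neg fun h2 => h1 h2.le]

/-- Each direction `k` contributes $\beta_k$ copies of the same variable, and
$\sum_k\beta_k=|\beta|$ produces the degree. -/
lemma isSkorokhod_wick (hW : IsWhiteNoise P W) (β : ι →₀ ℕ) (c : ℝ) :
    IsSkorokhod P W u
      (fun k => if β k = 0 then 0 else c • wickLp u hW (β - Finsupp.single k 1))
      ((c * β.degree) • wickLp u hW β) := by
  have hz {k : ι} (hk : k ∉ β.support) : β k = 0 := by
    simpa using hk
  refine ⟨memℓp_of_finite_support (β.support.finite_toSet.subset fun k hk => ?_),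
    fun φ G hG => ?_⟩
  · by_contra hc
    exact hk (if_pos (hz hc))
  · have hR : ∫ ω, φ ω • ((c * β.degree) • wickLp u hW β : Lp ℝ 2 P) ω ∂P =
        ∑ k ∈ β.support, c * (β k * ∫ ω, wick W u β ω * φ ω ∂P) := by
      rw [← Finset.mul_sum, ← Finset.sum_mul, ← mul_assoc]
      have : (∑ k ∈ β.support, (β k : ℝ)) = β.degree := by
        rw [Finsupp.degree_apply]; push_cast; rfl
      rw [this, ← integral_const_mul]
      refine integral_congr_ae ?_
      filter_upwards [coeFn_wickLp u hW β, Lp.coeFn_smul (c * β.degree) (wickLp u hW β)]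
        with ω h1 h2
      rw [h2, Pi.smul_apply, h1]
      simp only [smul_eq_mul]
      ring
    rw [hR]
    have hL (k : ι) : ∫ ω, ⟪u k, G ω⟫_ℝ •
        (if β k = 0 then 0 else c • wickLp u hW (β - Finsupp.single k 1) : Lp ℝ 2 P) ω ∂P =
        c * (β k * ∫ ω, wick W u β ω * φ ω ∂P) := by
      split_ifs with hk
      · rw [hk]
        simp only [Nat.cast_zero, zero_mul, mul_zero]
        refine integral_eq_zero_of_ae ?_
        filter_upwards [Lp.coeFn_zero ℝ 2 P] with ω h1
        rw [h1]; simp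
      · obtain ⟨γ, rfl⟩ : ∃ γ, β = γ + Finsupp.single k 1 := ⟨_, eq_add_single_of_ne_zero hk⟩
        have := integral_wick_mul_inner u hW γ k hG
        simp only [Finsupp.add_apply, Finsupp.single_eq_same, Nat.cast_add, Nat.cast_one]
        rw [← this, ← integral_const_mul]
        refine integral_congr_ae ?_
        rw [add_tsub_cancel_right]
        filter_upwards [coeFn_wickLp u hW γ, Lp.coeFn_smul c (wickLp u hW γ)] with ω h1 h2
        rw [h2, Pi.smul_apply, h1]
        simp only [smul_eq_mul]
        ring
    simp only [hL]
    exact hasSum_sum_of_ne_finset_zero fun k hk => by rw [hz hk]; simp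

-- The partial integrals are explicit: with `n` slots left open, the coordinate at `i` is $m!$ times
-- `wick` at $\alpha-\mathrm{occ}\,i$, where $m$ is the degree of that multi-index. One further
-- integration multiplies by the new degree, which advances the factorial.
open Classical in
lemma isIteratedSkorokhod_wick (hW : IsWhiteNoise P W) (α : ι →₀ ℕ) {n : ℕ}
    (hn : n ≤ α.degree) :
    IsIteratedSkorokhod P W u n
      (fun i => if occ i ≤ α then
        (((α - occ i).degree.factorial : ℝ)) • wickLp u hW (α - occ i) else 0)
      ((α.degree.factorial : ℝ) • wickLp u hW α) := by
  have hmem (n : ℕ) : Memℓp (fun i : Fin n → ι => if occ i ≤ α then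
      (((α - occ i).degree.factorial : ℝ)) • wickLp u hW (α - occ i) else 0) 2 :=
    memℓp_of_finite_support ((finite_occ_le n α).subset fun i hi => by
      by_contra hc
      exact hi (if_neg hc))
  induction n with
  | zero =>
    simp [IsIteratedSkorokhod, occ_elim0]
  | succ n ih =>
    refine ⟨hmem _, _, hmem n, fun j => ?_, ih (by omega)⟩
    by_cases hj : occ j ≤ α
    · simp only [occ_cons_le_iff, hj, true_and, tsub_occ_cons, ne_eq, ite_not, if_true]
      set β := α - occ j with hβ
      have hd : β.degree + n = α.degree := by
        have := congrArg Finsupp.degree (tsub_add_cancel_of_le hj)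
        rwa [map_add, degree_occ] at this
      obtain ⟨m, hm⟩ : ∃ m, β.degree = m + 1 := Nat.exists_eq_succ_of_ne_zero (by omega)
      have := isSkorokhod_wick u hW β (m.factorial : ℝ)
      rw [hm, Nat.factorial_succ, Nat.mul_comm, Nat.cast_mul]
      rw [hm] at this
      convert this using 3 with k
      rename_i hk
      have := congrArg Finsupp.degree (eq_add_single_of_ne_zero hk)
      rw [map_add, Finsupp.degree_single, hm] at this
      rw [Nat.succ.inj this]
    · simp only [occ_cons_le_iff, hj, false_and, if_false]
      exact IsSkorokhod.zero

variable (q : ι → ℝ) (r : ℝ)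

-- The kernel is the indicator of the tuples counted by `α`. Its iterated integral is $|\alpha|!$
-- times the variable, which cancels the $1/n!$ in the chaos expansion.
open Classical in
lemma wick_mem_chaosSubmodule (hW : IsWhiteNoise P W) (α : ι →₀ ℕ) :
    (wickLp u hW α, fun n (i : Fin n → ι) => if occ i = α then (1 : ℝ) else 0) ∈
      chaosSubmodule P W u q r ℝ := by
  have hfin (n : ℕ) (i : Fin n → ι) (h : (if occ i = α then (1 : ℝ) else 0) ≠ 0) : occ i = α := by
    by_contra hc
    exact h (if_neg hc)
  refine ⟨(Set.finite_singleton α.degree).subset fun n hn => ?_, fun n => ⟨fun σ i => ?_, ?_, ?_⟩,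
    Finsupp.single α.degree ((α.degree.factorial : ℝ) • wickLp u hW α), fun n => ?_, ?_⟩
  · obtain ⟨i, hi⟩ := Function.ne_iff.1 (show (fun i : Fin n → ι => _) ≠ _ from hn)
    rw [Set.mem_singleton_iff, ← hfin n i hi, degree_occ]
  · simp only [occ_comp_perm]
  · exact memℓp_of_finite_support ((finite_occ_le n α).subset fun i hi => (hfin n i hi).le)
  · exact memℓp_of_finite_support ((finite_occ_le n α).subset fun i hi =>
      (hfin n i (right_ne_zero_of_smul hi)).le)
  · have hc (c : ℝ) : Lp.const 2 P c = c • wickLp u hW 0 := by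
      refine Lp.ext ?_
      filter_upwards [Lp.coeFn_const 2 P c, Lp.coeFn_smul c (wickLp u hW 0),
        coeFn_wickLp u hW 0] with ω h1 h2 h3
      rw [h1, h2, Pi.smul_apply, h3]
      simp
    by_cases hn : n = α.degree
    · subst hn
      rw [Finsupp.single_eq_same]
      convert isIteratedSkorokhod_wick u hW α le_rfl using 2 with i
      rw [hc]
      by_cases h1 : occ i ≤ α
      -- Here the tuple length equals $|\alpha|$, so the difference of multi-indices has degree
      -- zero.
      · have h2 : occ i = α := by
          have h3 := tsub_add_cancel_of_le h1
          have h4 := congrArg Finsupp.degree h3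
          rw [map_add, degree_occ] at h4
          have h5 : α - occ i = 0 := (Finsupp.degree_eq_zero_iff _).1 (by omega)
          rwa [h5, zero_add] at h3
        simp [h2]
      · have h2 : occ i ≠ α := fun h2 => h1 h2.le
        simp [h1, h2]
    · rw [Finsupp.single_eq_of_ne hn]
      have : (fun i : Fin n → ι => Lp.const 2 P (if occ i = α then (1 : ℝ) else 0)) = 0 := by
        ext1 i
        rw [if_neg, map_zero]
        · rfl
        · rintro rfl
          exact hn (degree_occ i).symm
      change IsIteratedSkorokhod P W u n
        (fun i : Fin n → ι => Lp.const 2 P (if occ i = α then (1 : ℝ) else 0)) 0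
      rw [this]
      exact IsIteratedSkorokhod.zero
  · rw [Finsupp.sum_single_index (by simp), smul_smul, one_div_mul_cancel (by positivity), one_smul]

variable {q r}

/-- Only the chaos of order $|\alpha|$ pairs non-trivially with `wick α`, since tuples of another
length cannot have occurrence count `α`. -/
lemma ChaosSpace.integral_wick_smul_rv (hW : IsWhiteNoise P W) (η : ChaosSpace P W u q r X)
    (α : ι →₀ ℕ) : ∫ ω, wick W u α ω • η.rv ω ∂P =
      ∑ s ∈ fiber α, (1 / (s.1.factorial : ℝ)) • η.kernel s.1 s.2 := by
  classical
  obtain ⟨-, -, I, hI, hη⟩ := η.2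
  let T : Lp X 2 P →ₗ[ℝ] X :=
    { toFun := fun g => ∫ ω, wick W u α ω • g ω ∂P
      map_add' := integral_smul_add P (hasMoments_wick u hW α).memLp_two
      map_smul' := fun c g => by
        rw [RingHom.id_apply, ← integral_smul]
        refine integral_congr_ae ?_
        filter_upwards [Lp.coeFn_smul c g] with ω h1
        rw [h1, Pi.smul_apply, smul_comm] }
  have hT (n : ℕ) : T (I n) = ∑ i ∈ Fintype.piFinset fun _ : Fin n => α.support,
      if occ i = α then η.kernel n i else 0 := (hI n).integral_wick_smul_const u hW α
  have hT0 {n : ℕ} (hn : n ≠ α.degree) : T (I n) = 0 := by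
    rw [hT]
    refine Finset.sum_eq_zero fun i _ => if_neg ?_
    rintro rfl
    exact hn (degree_occ i).symm
  have hη' : η.rv = I.sum fun n g => (1 / (n.factorial : ℝ)) • g := hη
  change T η.rv = _
  rw [hη', map_finsuppSum, Finsupp.sum, Finset.sum_eq_single α.degree
    (fun n _ hn => by rw [_root_.map_smul, hT0 hn, smul_zero])
    (fun h => by rw [Finsupp.notMem_support_iff.1 h]; simp), _root_.map_smul, hT, fiber,
    Finset.sum_map, Finset.sum_filter, Finset.smul_sum]
  refine Finset.sum_congr rfl fun i _ => ?_
  split_ifs <;> simp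

end Duality

/-! ### Weights on multi-indices -/

section Weights

variable {ι : Type*} (q : ι → ℝ) (r : ℝ)

/-- The weight `q^{rα}`. -/
def multiWeight (α : ι →₀ ℕ) : ℝ := α.prod fun k n => (q k ^ r) ^ n

lemma tensorWeight_eq {n : ℕ} (i : Fin n → ι) : tensorWeight q r i = multiWeight q r (occ i) := by
  rw [multiWeight, occ, ← Finsupp.prod_finsetSum_index (by simp) (by simp [pow_add])]
  simp [tensorWeight]

variable {q}

lemma multiWeight_pos (hq : ∀ k, 1 ≤ q k) (α : ι →₀ ℕ) : 0 < multiWeight q r α :=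
  Finset.prod_pos fun k _ => pow_pos (Real.rpow_pos_of_pos (zero_lt_one.trans_le (hq k)) r) _

variable (q) in
/-- The weight `|α|! q^{-2rα}` of the dual space. -/
def dualWeight (α : ι →₀ ℕ) : ℝ := (α.degree.factorial : ℝ) * (multiWeight q r α ^ 2)⁻¹

lemma dualWeight_pos (hq : ∀ k, 1 ≤ q k) (α : ι →₀ ℕ) : 0 < dualWeight q r α := by
  have := multiWeight_pos r hq α
  unfold dualWeight
  positivity

lemma dualWeight_eq (hq : ∀ k, 1 ≤ q k) (α : ι →₀ ℕ) :
    dualWeight q r α = (α.degree.factorial : ℝ) * α.prod fun k n => q k ^ (-2 * r * (n : ℝ)) := by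
  rw [dualWeight, multiWeight, Finsupp.prod, ← Finset.prod_pow, ← Finset.prod_inv_distrib]
  congr 1
  refine Finset.prod_congr rfl fun k _ => ?_
  have h0 : 0 ≤ q k := zero_le_one.trans (hq k)
  rw [← Real.rpow_natCast, ← Real.rpow_natCast, ← Real.rpow_mul h0, ← Real.rpow_mul h0,
    ← Real.rpow_neg h0]
  congr 1
  push_cast
  ring

end Weights

/-! ### The chaos space as a weighted sequence space -/

section Coefficients

set_option linter.unusedSectionVars false

variable {Ω U ι X : Type*} [MeasurableSpace Ω]
  [NormedAddCommGroup U] [InnerProductSpace ℝ U]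
  [NormedAddCommGroup X] [InnerProductSpace ℝ X] [CompleteSpace X]
  {P : Measure Ω} [IsProbabilityMeasure P] {W : U → Ω → ℝ} (u : HilbertBasis ι ℝ U)
  {q : ι → ℝ} {r : ℝ}

namespace ChaosSpace

lemma coord_apply (η : ChaosSpace P W u q r X) (s : Σ n : ℕ, (Fin n → ι)) :
    coord P W u q r X η s =
      (1 / (s.1.factorial : ℝ)) • tensorWeight q r s.2 • η.kernel s.1 s.2 := rfl

variable (q r) in
/-- The variable `∏ₖ H_{αₖ}(W(uₖ)) / αₖ!` as an element of `(L)_{Q,r}`. -/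
def wick (hW : IsWhiteNoise P W) (α : ι →₀ ℕ) : ChaosSpace P W u q r ℝ :=
  ⟨_, wick_mem_chaosSubmodule u q r hW α⟩

open Classical in
lemma kernel_wick (hW : IsWhiteNoise P W) (α : ι →₀ ℕ) (n : ℕ) (i : Fin n → ι) :
    (wick u q r hW α).kernel n i = if occ i = α then 1 else 0 := rfl

lemma rv_wick (hW : IsWhiteNoise P W) (α : ι →₀ ℕ) :
    (wick u q r hW α).rv = wickLp u hW α := rfl

end ChaosSpace

/-- The multinomial count `α! · #{i : occ i = α} = |α|!`. -/
lemma card_fiber_mul (u : HilbertBasis ι ℝ U) (hW : IsWhiteNoise P W) (α : ι →₀ ℕ) :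
    ((fiber α).card : ℝ) * multiFactorial α = (α.degree.factorial : ℝ) := by
  -- The count comes from evaluating $E(w_\alpha^2)$ twice: as $1/\alpha!$, and as the sum of the
  -- indicator kernel over the fiber divided by $|\alpha|!$. The weights `1` and `0` are arbitrary.
  have h := ChaosSpace.integral_wick_smul_rv u hW (ChaosSpace.wick u (fun _ => 1) 0 hW α) α
  have h1 : ∫ ω, wick W u α ω • (ChaosSpace.wick u (fun _ => 1) 0 hW α).rv ω ∂P =
      (multiFactorial α)⁻¹ := by
    rw [← integral_wick_mul_self u hW α]
    refine integral_congr_ae ?_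
    filter_upwards [coeFn_wickLp u hW α] with ω h1
    rw [ChaosSpace.rv_wick, h1, smul_eq_mul]
  have h2 : ∑ s ∈ fiber α, (1 / (s.1.factorial : ℝ)) •
      (ChaosSpace.wick u (fun _ => 1) 0 hW α).kernel s.1 s.2 =
      (fiber α).card * (α.degree.factorial : ℝ)⁻¹ := by
    rw [← nsmul_eq_mul]
    refine Finset.sum_eq_card_nsmul fun s hs => ?_
    rw [ChaosSpace.kernel_wick, if_pos (mem_fiber.1 hs), fst_of_mem_fiber hs]
    simp
  rw [h1, h2] at h
  have h3 := (multiFactorial_pos α).ne'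
  have h4 : (α.degree.factorial : ℝ) ≠ 0 := by positivity
  field_simp at h
  linarith

namespace ChaosSpace

/-- The kernels are determined by the random element. -/
lemma kernel_eq (hW : IsWhiteNoise P W) (η : ChaosSpace P W u q r X) {n : ℕ} (i : Fin n → ι) :
    η.kernel n i =
      multiFactorial (occ i) • ∫ ω, WhiteNoise.wick W u (occ i) ω • η.rv ω ∂P := by
  have hker (m : ℕ) (σ : Equiv.Perm (Fin m)) (i : Fin m → ι) :
      η.kernel m (i ∘ σ) = η.kernel m i := (η.2.2.1 m).symm σ i
  rw [integral_wick_smul_rv u hW]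
  -- All tuples in the fiber are rearrangements of `i`, so a symmetric kernel is constant there and
  -- the sum determines its value.
  have h (s : Σ n : ℕ, (Fin n → ι)) (hs : s ∈ fiber (occ i)) :
      (1 / (s.1.factorial : ℝ)) • η.kernel s.1 s.2 = (1 / (n.factorial : ℝ)) • η.kernel n i := by
    obtain ⟨m, j⟩ := s
    obtain rfl : m = n := (fst_of_mem_fiber hs).trans (degree_occ i)
    have hji : occ j = occ i := mem_fiber.1 hs
    obtain ⟨σ, rfl⟩ := exists_perm_of_occ_eq hji
    rw [hker]
  have h1 := card_fiber_mul u hW (occ i)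
  rw [degree_occ] at h1
  have h2 : multiFactorial (occ i) * ((fiber (occ i)).card * (1 / (n.factorial : ℝ))) = 1 := by
    rw [← mul_assoc, mul_comm (multiFactorial _), h1, mul_one_div_cancel (by positivity)]
  rw [Finset.sum_eq_card_nsmul h]
  generalize η.kernel n i = c
  rw [← Nat.cast_smul_eq_nsmul ℝ, ← mul_smul, ← mul_smul, mul_assoc, h2, one_smul]

lemma coord_eq_of_rv_eq (hW : IsWhiteNoise P W) {η θ : ChaosSpace P W u q r X}
    (h : η.rv = θ.rv) : coord P W u q r X η = coord P W u q r X θ := by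
  ext s
  rw [coord_apply, coord_apply, kernel_eq u hW, kernel_eq u hW, h]

open Classical in
lemma coord_sum_wick (hW : IsWhiteNoise P W) (S : Finset (ι →₀ ℕ)) (d : (ι →₀ ℕ) → ℝ)
    (s : Σ n : ℕ, (Fin n → ι)) :
    coord P W u q r ℝ (∑ α ∈ S, d α • wick u q r hW α) s =
      if occ s.2 ∈ S then d (occ s.2) * (multiWeight q r (occ s.2) / (s.1.factorial : ℝ))
      else 0 := by
  rw [map_sum, lp.coeFn_sum, Finset.sum_apply]
  simp only [_root_.map_smul, lp.coeFn_smul, Pi.smul_apply, coord_apply, kernel_wick,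
    tensorWeight_eq, smul_eq_mul, mul_ite, mul_one, mul_zero]
  rw [Finset.sum_ite_eq]
  split_ifs <;> ring

lemma pairwiseDisjoint_fiber (S : Set (ι →₀ ℕ)) : S.PairwiseDisjoint (fiber (ι := ι)) := by
  intro α _ β _ h
  refine Finset.disjoint_left.2 fun s hs ht => h ?_
  rw [← mem_fiber.1 hs, mem_fiber.1 ht]

/-- Distinct `wick` variables live on disjoint fibers, hence are orthogonal. Each fiber has
$|\alpha|!/\alpha!$ points, all with the same coordinate, and this turns $(1/|\alpha|!)^2$ into
$1/(\alpha!\,|\alpha|!)$. -/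
lemma norm_sq_sum_wick (hW : IsWhiteNoise P W) (S : Finset (ι →₀ ℕ)) (d : (ι →₀ ℕ) → ℝ) :
    ‖∑ α ∈ S, d α • wick u q r hW α‖ ^ 2 = ∑ α ∈ S,
      d α ^ 2 * (multiWeight q r α ^ 2 / (multiFactorial α * (α.degree.factorial : ℝ))) := by
  classical
  change ‖coord P W u q r ℝ (∑ α ∈ S, d α • wick u q r hW α)‖ ^ 2 = _
  have h := lp.norm_rpow_eq_tsum (p := 2) (by simp)
    (coord P W u q r ℝ (∑ α ∈ S, d α • wick u q r hW α))
  simp only [ENNReal.toReal_ofNat, Real.rpow_ofNat] at h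
  rw [h, tsum_eq_sum (s := S.biUnion fiber), Finset.sum_biUnion (pairwiseDisjoint_fiber _)]
  · refine Finset.sum_congr rfl fun α hα => ?_
    have h1 (s) (hs : s ∈ fiber α) :
        ‖coord P W u q r ℝ (∑ α ∈ S, d α • wick u q r hW α) s‖ ^ 2 =
          (d α * (multiWeight q r α / (α.degree.factorial : ℝ))) ^ 2 := by
      rw [coord_sum_wick, mem_fiber.1 hs, fst_of_mem_fiber hs, if_pos hα, Real.norm_eq_abs, sq_abs]
    rw [Finset.sum_eq_card_nsmul h1, nsmul_eq_mul]
    have h2 := card_fiber_mul u hW α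
    have h3 := multiFactorial_pos α
    have h4 : (0 : ℝ) < (α.degree.factorial : ℝ) := by positivity
    rw [← h2] at h4 ⊢
    have h5 : (0 : ℝ) < (fiber α).card := pos_of_mul_pos_left h4 h3.le
    field_simp
  · intro s hs
    rw [coord_sum_wick, if_neg, norm_zero, zero_pow two_ne_zero]
    intro hc
    exact hs (Finset.mem_biUnion.2 ⟨_, hc, mem_fiber.2 rfl⟩)

/-- Truncations to finitely many multi-indices converge. -/
lemma hasSum_wick (hW : IsWhiteNoise P W) (η : ChaosSpace P W u q r ℝ) :
    HasSum (fun α => (multiFactorial α * ∫ ω, WhiteNoise.wick W u α ω • η.rv ω ∂P) •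
      wick u q r hW α) η := by
  classical
  -- Unions of fibers are cofinal among finite sets of tuples, so the coordinate expansion in
  -- $\ell_2$ may be summed fiber by fiber.
  have hT : Filter.Tendsto (fun S : Finset (ι →₀ ℕ) => S.biUnion fiber)
      Filter.atTop Filter.atTop :=
    Filter.tendsto_atTop_finset_of_monotone
      (fun S T h => Finset.biUnion_subset_biUnion_of_subset_left _ h)
      fun s => ⟨{occ s.2}, by simp [mem_fiber]⟩
  have h1 : HasSum _ (coord P W u q r ℝ η) := lp.hasSum_single (by simp) (coord P W u q r ℝ η)
  have h2 := h1.comp hT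
  rw [HasSum] at *
  rw [SummationFilter.unconditional_filter, tendsto_iff_norm_sub_tendsto_zero] at *
  refine h2.congr fun S => ?_
  change _ = ‖coord P W u q r ℝ (_ - η)‖
  rw [map_sub]
  congr 2
  ext s
  rw [coord_sum_wick]
  simp only [Function.comp_apply, lp.coeFn_sum, Finset.sum_apply, lp.single_apply,
    Pi.single_apply]
  rw [Finset.sum_ite_eq]
  have hmem : s ∈ S.biUnion fiber ↔ occ s.2 ∈ S := by
    simp [mem_fiber]
  simp only [hmem]
  split_ifs with h
  · rw [coord_apply, kernel_eq u hW, tensorWeight_eq]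
    simp only [smul_eq_mul]
    ring
  · rfl

end ChaosSpace

end Coefficients

/-! ### Coefficients, the series functional and the dual norm -/

section Series

set_option linter.unusedSectionVars false

variable {Ω U ι X : Type*} [MeasurableSpace Ω]
  [NormedAddCommGroup U] [InnerProductSpace ℝ U]
  [NormedAddCommGroup X] [InnerProductSpace ℝ X] [CompleteSpace X]
  {P : Measure Ω} [IsProbabilityMeasure P] {W : U → Ω → ℝ} {u : HilbertBasis ι ℝ U}
  {q : ι → ℝ} {r : ℝ}

lemma hasMoments_xi (hW : IsWhiteNoise P W) (α : ι →₀ ℕ) : HasMoments (xi W u α) P := by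
  have h : xi W u α = fun ω => √(multiFactorial α) * wick W u α ω := funext (xi_eq u α)
  rw [h]
  exact (HasMoments.const _).mul (hasMoments_wick u hW α)

namespace ChaosSpace

lemma integral_xi_smul_rv (η : ChaosSpace P W u q r X) (α : ι →₀ ℕ) :
    ∫ ω, xi W u α ω • η.rv ω ∂P =
      √(multiFactorial α) • ∫ ω, WhiteNoise.wick W u α ω • η.rv ω ∂P := by
  rw [← integral_smul]
  simp only [xi_eq, mul_smul]

/-- The `ℓ²` mass of `η` at the multi-index `α`. -/
def mass (η : ChaosSpace P W u q r X) (α : ι →₀ ℕ) : ℝ :=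
  ∑ s ∈ fiber α, ‖coord P W u q r X η s‖ ^ 2

lemma mass_nonneg (η : ChaosSpace P W u q r X) (α : ι →₀ ℕ) : 0 ≤ η.mass α :=
  Finset.sum_nonneg fun _ _ => by positivity

lemma sum_mass_le (η : ChaosSpace P W u q r X) (S : Finset (ι →₀ ℕ)) :
    ∑ α ∈ S, η.mass α ≤ ‖η‖ ^ 2 := by
  classical
  have h := lp.sum_rpow_le_norm_rpow (p := 2) (by simp) (coord P W u q r X η) (S.biUnion fiber)
  simp only [ENNReal.toReal_ofNat, Real.rpow_ofNat] at h
  rw [Finset.sum_biUnion (pairwiseDisjoint_fiber _)] at h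
  exact h

/-- Cauchy-Schwarz over the fiber costs its cardinality. With the factor $\alpha!$ from $\xi_\alpha$
this makes $|\alpha|!$, exactly the factorial in the dual weight. -/
lemma norm_integral_xi_smul_rv_le (hW : IsWhiteNoise P W) (hq : ∀ k, 1 ≤ q k)
    (η : ChaosSpace P W u q r X) (α : ι →₀ ℕ) :
    ‖∫ ω, xi W u α ω • η.rv ω ∂P‖ ≤ √(dualWeight q r α) * √(η.mass α) := by
  have hw := multiWeight_pos r hq α
  have hf := multiFactorial_pos α
  rw [integral_xi_smul_rv, integral_wick_smul_rv u hW, ← Real.sqrt_mul (dualWeight_pos r hq α).le]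
  refine Real.le_sqrt_of_sq_le ?_
  have h1 : ∑ s ∈ fiber α, (1 / (s.1.factorial : ℝ)) • η.kernel s.1 s.2 =
      (multiWeight q r α)⁻¹ • ∑ s ∈ fiber α, coord P W u q r X η s := by
    rw [Finset.smul_sum]
    refine Finset.sum_congr rfl fun s hs => ?_
    rw [coord_apply, tensorWeight_eq, mem_fiber.1 hs, smul_comm, smul_smul, smul_smul,
      inv_mul_cancel_right₀ hw.ne']
  rw [h1, norm_smul, norm_smul, Real.norm_of_nonneg (by positivity),
    Real.norm_of_nonneg (by positivity), mul_pow, mul_pow, Real.sq_sqrt hf.le]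
  have h2 : ‖∑ s ∈ fiber α, coord P W u q r X η s‖ ^ 2 ≤ (fiber α).card * η.mass α := by
    refine le_trans ?_ (sq_sum_le_card_mul_sum_sq (s := fiber α)
      (f := fun s => ‖coord P W u q r X η s‖))
    gcongr
    exact norm_sum_le _ _
  rw [dualWeight, ← card_fiber_mul u hW α]
  calc multiFactorial α * ((multiWeight q r α)⁻¹ ^ 2 * ‖∑ s ∈ fiber α, coord P W u q r X η s‖ ^ 2)
      ≤ multiFactorial α * ((multiWeight q r α)⁻¹ ^ 2 * ((fiber α).card * η.mass α)) := by
        gcongr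
    _ = _ := by rw [inv_pow]; ring

/-- The coefficient at `ξ_α` as a bounded operator. -/
def coeffCLM (hW : IsWhiteNoise P W) (hq : ∀ k, 1 ≤ q k) (α : ι →₀ ℕ) :
    ChaosSpace P W u q r X →L[ℝ] X :=
  LinearMap.mkContinuous
    { toFun := fun η => ∫ ω, xi W u α ω • η.rv ω ∂P
      map_add' := fun η θ => integral_smul_add P (hasMoments_xi hW α).memLp_two η.rv θ.rv
      map_smul' := fun c η => by
        have hc : (c • η).rv = c • η.rv := rfl
        rw [RingHom.id_apply, ← integral_smul, hc]
        refine integral_congr_ae ?_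
        filter_upwards [Lp.coeFn_smul c η.rv] with ω h1
        rw [h1, Pi.smul_apply, smul_comm] }
    √(dualWeight q r α) fun η => by
      refine (norm_integral_xi_smul_rv_le hW hq η α).trans ?_
      gcongr
      refine Real.sqrt_le_iff.2 ⟨norm_nonneg _, ?_⟩
      simpa using η.sum_mass_le {α}

end ChaosSpace

namespace LSpace

/-- `Completion.extension` agrees with the given map only when that map is suitably continuous; the
bound in `coeffCLM` supplies this. -/
lemma coeff_coe (hW : IsWhiteNoise P W) (hq : ∀ k, 1 ≤ q k) (α : ι →₀ ℕ)
    (η : ChaosSpace P W u q r X) :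
    coeff α (η : LSpace P W u q r X) = ∫ ω, xi W u α ω • η.rv ω ∂P :=
  UniformSpace.Completion.extension_coe (ChaosSpace.coeffCLM hW hq α).uniformContinuous η

lemma continuous_coeff (α : ι →₀ ℕ) : Continuous (coeff α : LSpace P W u q r X → X) :=
  UniformSpace.Completion.continuous_extension

lemma coeff_add (hW : IsWhiteNoise P W) (hq : ∀ k, 1 ≤ q k) (α : ι →₀ ℕ)
    (η θ : LSpace P W u q r X) : coeff α (η + θ) = coeff α η + coeff α θ := by
  have hc := continuous_coeff (P := P) (W := W) (u := u) (q := q) (r := r) (X := X) α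
  induction η, θ using UniformSpace.Completion.induction_on₂ with
  | hp => exact isClosed_eq (by fun_prop) (by fun_prop)
  | ih η θ =>
    rw [← UniformSpace.Completion.coe_add, coeff_coe hW hq, coeff_coe hW hq, coeff_coe hW hq]
    exact (ChaosSpace.coeffCLM hW hq α).map_add η θ

lemma coeff_smul (hW : IsWhiteNoise P W) (hq : ∀ k, 1 ≤ q k) (α : ι →₀ ℕ) (c : ℝ)
    (η : LSpace P W u q r X) : coeff α (c • η) = c • coeff α η := by
  have hc := continuous_coeff (P := P) (W := W) (u := u) (q := q) (r := r) (X := X) α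
  induction η using UniformSpace.Completion.induction_on with
  | hp => exact isClosed_eq (hc.comp (continuous_const_smul c)) (hc.const_smul c)
  | ih η =>
    rw [← UniformSpace.Completion.coe_smul]
    refine (coeff_coe hW hq α (c • η)).trans ?_
    rw [coeff_coe hW hq α η]
    exact (ChaosSpace.coeffCLM hW hq α).map_smul c η

lemma coeff_inner (hW : IsWhiteNoise P W) (hq : ∀ k, 1 ≤ q k) (α : ι →₀ ℕ) (x : X)
    (η : LSpace P W u q r X) : coeff α (LSpace.inner x η) = ⟪x, coeff α η⟫_ℝ := by
  have hc := continuous_coeff (P := P) (W := W) (u := u) (q := q) (r := r) (X := X) α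
  have hc' := continuous_coeff (P := P) (W := W) (u := u) (q := q) (r := r) (X := ℝ) α
  induction η using UniformSpace.Completion.induction_on with
  | hp => exact isClosed_eq (by fun_prop) (by fun_prop)
  | ih η =>
    rw [inner_coe, coeff_coe hW hq, coeff_coe hW hq]
    exact integral_smul_map P (hasMoments_xi hW α).memLp_two η.rv (innerSL ℝ x)

variable {ζ : (ι →₀ ℕ) → ℝ}

/-- A second Cauchy-Schwarz, now over multi-indices. Restricting to a finite `S` keeps the
inequality a closed condition, so it extends to the completion. -/
lemma sum_norm_smul_coeff_le (hW : IsWhiteNoise P W) (hq : ∀ k, 1 ≤ q k)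
    (hζ : Summable fun α => dualWeight q r α * ζ α ^ 2) (S : Finset (ι →₀ ℕ))
    (η : LSpace P W u q r X) :
    ∑ α ∈ S, ‖ζ α • coeff α η‖ ≤ √(∑' α, dualWeight q r α * ζ α ^ 2) * ‖η‖ := by
  have hc := continuous_coeff (P := P) (W := W) (u := u) (q := q) (r := r) (X := X)
  have hnn (α : ι →₀ ℕ) : 0 ≤ dualWeight q r α * ζ α ^ 2 :=
    mul_nonneg (dualWeight_pos r hq α).le (sq_nonneg _)
  induction η using UniformSpace.Completion.induction_on with
  | hp => exact isClosed_le (by fun_prop) (by fun_prop)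
  | ih η =>
    rw [UniformSpace.Completion.norm_coe]
    calc ∑ α ∈ S, ‖ζ α • coeff α (η : LSpace P W u q r X)‖
        ≤ ∑ α ∈ S, √(dualWeight q r α * ζ α ^ 2) * √(η.mass α) := by
          refine Finset.sum_le_sum fun α _ => ?_
          rw [coeff_coe hW hq, norm_smul, Real.sqrt_mul (dualWeight_pos r hq α).le,
            Real.sqrt_sq_eq_abs, Real.norm_eq_abs, mul_comm _ |ζ α|, mul_assoc]
          gcongr
          exact ChaosSpace.norm_integral_xi_smul_rv_le hW hq η α
      _ ≤ √(∑ α ∈ S, dualWeight q r α * ζ α ^ 2) * √(∑ α ∈ S, η.mass α) :=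
          Real.sum_sqrt_mul_sqrt_le S hnn η.mass_nonneg
      _ ≤ √(∑' α, dualWeight q r α * ζ α ^ 2) * ‖η‖ := by
          gcongr
          · exact hζ.sum_le_tsum S fun α _ => hnn α
          · exact Real.sqrt_le_iff.2 ⟨norm_nonneg _, η.sum_mass_le S⟩

lemma summable_norm_smul_coeff (hW : IsWhiteNoise P W) (hq : ∀ k, 1 ≤ q k)
    (hζ : Summable fun α => dualWeight q r α * ζ α ^ 2) (η : LSpace P W u q r X) :
    Summable fun α => ‖ζ α • coeff α η‖ :=
  summable_of_sum_le (fun _ => norm_nonneg _) fun S => sum_norm_smul_coeff_le hW hq hζ S η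

end LSpace

variable {ζ : (ι →₀ ℕ) → ℝ}

variable (u) in
/-- The functional `η ↦ ∑_α ζ_α η_α`. -/
def seriesFunctional (hW : IsWhiteNoise P W) (hq : ∀ k, 1 ≤ q k)
    (hζ : Summable fun α => dualWeight q r α * ζ α ^ 2) : LDual P W u q r :=
  LinearMap.mkContinuous
    { toFun := fun η => ∑' α, ζ α • LSpace.coeff α η
      map_add' := fun η θ => by
        rw [← (LSpace.summable_norm_smul_coeff hW hq hζ η).of_norm.tsum_add
          (LSpace.summable_norm_smul_coeff hW hq hζ θ).of_norm]
        simp only [LSpace.coeff_add hW hq, smul_add]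
      map_smul' := fun c η => by
        rw [RingHom.id_apply, ← tsum_const_smul'']
        simp only [LSpace.coeff_smul hW hq, smul_comm c] }
    √(∑' α, dualWeight q r α * ζ α ^ 2) fun η =>
      (norm_tsum_le_tsum_norm (LSpace.summable_norm_smul_coeff hW hq hζ η)).trans
        (Real.tsum_le_of_sum_le (fun _ => norm_nonneg _)
          fun S => LSpace.sum_norm_smul_coeff_le hW hq hζ S η)

lemma hasSum_seriesFunctional (hW : IsWhiteNoise P W) (hq : ∀ k, 1 ≤ q k)
    (hζ : Summable fun α => dualWeight q r α * ζ α ^ 2) (η : LSpace P W u q r ℝ) :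
    HasSum (fun α => ζ α • LSpace.coeff α η) (seriesFunctional u hW hq hζ η) :=
  (LSpace.summable_norm_smul_coeff hW hq hζ η).of_norm.hasSum

namespace ChaosSpace

variable (u q r) in
/-- The variable `ξ_α` as an element of `(L)_{Q,r}`. -/
def xi (hW : IsWhiteNoise P W) (α : ι →₀ ℕ) : ChaosSpace P W u q r ℝ :=
  √(multiFactorial α) • wick u q r hW α

lemma rv_xi (hW : IsWhiteNoise P W) (α : ι →₀ ℕ) :
    (xi u q r hW α).rv =ᵐ[P] WhiteNoise.xi W u α := by
  have h : (xi u q r hW α).rv = √(multiFactorial α) • wickLp u hW α := rfl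
  rw [h]
  filter_upwards [Lp.coeFn_smul (√(multiFactorial α)) (wickLp u hW α), coeFn_wickLp u hW α]
    with ω h1 h2
  rw [h1, Pi.smul_apply, h2, xi_eq, smul_eq_mul]

open Classical in
lemma coeff_xi (hW : IsWhiteNoise P W) (hq : ∀ k, 1 ≤ q k) (α β : ι →₀ ℕ) :
    LSpace.coeff β (xi u q r hW α : LSpace P W u q r ℝ) = if β = α then 1 else 0 := by
  have h1 : LSpace.coeff β (wick u q r hW α : LSpace P W u q r ℝ) =
      if β = α then (√(multiFactorial α))⁻¹ else 0 := by
    rw [LSpace.coeff_coe hW hq, integral_xi_smul_rv, integral_wick_smul_rv u hW]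
    have h2 (s) (hs : s ∈ fiber β) : (1 / (s.1.factorial : ℝ)) • (wick u q r hW α).kernel s.1 s.2 =
        (1 / (β.degree.factorial : ℝ)) * if β = α then 1 else 0 := by
      rw [kernel_wick, mem_fiber.1 hs, fst_of_mem_fiber hs, smul_eq_mul]
    rw [Finset.sum_eq_card_nsmul h2]
    split_ifs with h
    · subst h
      have h3 := card_fiber_mul u hW β
      have h4 := multiFactorial_pos β
      have h5 : (0 : ℝ) < (β.degree.factorial : ℝ) := by positivity
      have h6 := Real.mul_self_sqrt h4.le
      have h7 := Real.sqrt_pos.2 h4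
      rw [smul_eq_mul, nsmul_eq_mul]
      field_simp
      rw [sq, h6, mul_comm, h3]
    · simp
  rw [xi, UniformSpace.Completion.coe_smul, LSpace.coeff_smul hW hq, h1]
  split_ifs
  · exact mul_inv_cancel₀ (Real.sqrt_pos.2 (multiFactorial_pos α)).ne'
  · simp

/-- A functional sees only the random element. -/
lemma apply_eq_of_rv_eq (hW : IsWhiteNoise P W) (ℓ : LDual P W u q r)
    {η θ : ChaosSpace P W u q r ℝ} (h : η.rv =ᵐ[P] θ.rv) :
    ℓ (η : LSpace P W u q r ℝ) = ℓ (θ : LSpace P W u q r ℝ) := by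
  have h1 := coord_eq_of_rv_eq u hW (Lp.ext h)
  have h2 : ‖((η - θ : ChaosSpace P W u q r ℝ) : LSpace P W u q r ℝ)‖ = 0 := by
    rw [UniformSpace.Completion.norm_coe]
    change ‖coord P W u q r ℝ (η - θ)‖ = 0
    rw [map_sub, h1, sub_self, norm_zero]
  rw [norm_eq_zero, UniformSpace.Completion.coe_sub] at h2
  rw [sub_eq_zero.1 h2]

end ChaosSpace

/-- The representative of $\xi_\alpha$ in `IsFormalSeries` is merely some element; since the random
element fixes the kernels, it may be replaced by the canonical one. -/
lemma IsFormalSeries.apply_xi (hW : IsWhiteNoise P W) {ℓ : LDual P W u q r}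
    (h : IsFormalSeries ζ ℓ) (α : ι →₀ ℕ) :
    ℓ (ChaosSpace.xi u q r hW α : LSpace P W u q r ℝ) = ζ α := by
  obtain ⟨e, he, heζ⟩ := h α
  rw [← heζ]
  exact ChaosSpace.apply_eq_of_rv_eq hW ℓ ((ChaosSpace.rv_xi hW α).trans he.symm)

lemma isFormalSeries_seriesFunctional (hW : IsWhiteNoise P W) (hq : ∀ k, 1 ≤ q k)
    (hζ : Summable fun α => dualWeight q r α * ζ α ^ 2) :
    IsFormalSeries ζ (seriesFunctional u hW hq hζ) := by
  classical
  intro α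
  refine ⟨ChaosSpace.xi u q r hW α, ChaosSpace.rv_xi hW α, ?_⟩
  refine (hasSum_seriesFunctional hW hq hζ _).unique ?_
  simp only [ChaosSpace.coeff_xi hW hq, smul_eq_mul, mul_ite, mul_one, mul_zero]
  simpa using hasSum_single (f := fun β => if β = α then ζ β else 0) α
    fun β hβ => if_neg hβ

/-- A functional is determined by its values at the `ξ_α`. -/
lemma IsFormalSeries.unique (hW : IsWhiteNoise P W) {ℓ ℓ' : LDual P W u q r}
    (h : IsFormalSeries ζ ℓ) (h' : IsFormalSeries ζ ℓ') : ℓ = ℓ' := by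
  have hw (α : ι →₀ ℕ) : ℓ (ChaosSpace.wick u q r hW α : LSpace P W u q r ℝ) =
      ℓ' (ChaosSpace.wick u q r hW α : LSpace P W u q r ℝ) := by
    have h1 := (h.apply_xi hW α).trans (h'.apply_xi hW α).symm
    rw [ChaosSpace.xi, UniformSpace.Completion.coe_smul, map_smul, map_smul] at h1
    exact smul_right_injective ℝ (Real.sqrt_pos.2 (multiFactorial_pos α)).ne' h1
  ext η
  induction η using UniformSpace.Completion.induction_on with
  | hp => exact isClosed_eq ℓ.continuous ℓ'.continuous
  | ih η =>
    -- Continuity carries the expansion of `η` through both functionals, which agree term by term.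
    have h1 := (ChaosSpace.hasSum_wick u hW η).mapL
      (UniformSpace.Completion.toComplL (𝕜 := ℝ) (E := ChaosSpace P W u q r ℝ))
    have h2 := h1.mapL ℓ
    have h3 := h1.mapL ℓ'
    simp only [map_smul, UniformSpace.Completion.coe_toComplL, hw] at h2 h3
    exact h2.unique h3

lemma IsFormalSeries.summable (hW : IsWhiteNoise P W) (hq : ∀ k, 1 ≤ q k)
    {ℓ : LDual P W u q r} (h : IsFormalSeries ζ ℓ) :
    Summable fun α => dualWeight q r α * ζ α ^ 2 := by
  refine summable_of_sum_le (c := ‖ℓ‖ ^ 2)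
    (fun α => mul_nonneg (dualWeight_pos r hq α).le (sq_nonneg _)) fun S => ?_
  set A := ∑ α ∈ S, dualWeight q r α * ζ α ^ 2 with hA
  have hA0 : 0 ≤ A :=
    Finset.sum_nonneg fun α _ => mul_nonneg (dualWeight_pos r hq α).le (sq_nonneg _)
  -- This is the Riesz representative of the functional restricted to the span of $\xi_\alpha$,
  -- $\alpha\in S$: both $\|x\|^2$ and $\ell(x)$ equal the partial sum `A`.
  set x := ∑ α ∈ S, (dualWeight q r α * ζ α * √(multiFactorial α)) • ChaosSpace.wick u q r hW α
    with hx
  have hx2 : ‖x‖ ^ 2 = A := by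
    rw [hx, ChaosSpace.norm_sq_sum_wick]
    refine Finset.sum_congr rfl fun α _ => ?_
    have h1 := multiFactorial_pos α
    have h2 := multiWeight_pos r hq α
    have h3 : (0 : ℝ) < (α.degree.factorial : ℝ) := by positivity
    rw [mul_pow, Real.sq_sqrt h1.le, dualWeight]
    field_simp
  have hℓ : ℓ (x : LSpace P W u q r ℝ) = A := by
    have h1 : (x : LSpace P W u q r ℝ) =
        UniformSpace.Completion.toComplL (𝕜 := ℝ) (E := ChaosSpace P W u q r ℝ) x := rfl
    rw [h1, hx, map_sum, map_sum]
    refine Finset.sum_congr rfl fun α _ => ?_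
    rw [mul_smul, map_smul, map_smul]
    change (dualWeight q r α * ζ α) •
      ℓ (ChaosSpace.xi u q r hW α : LSpace P W u q r ℝ) = _
    rw [h.apply_xi hW, smul_eq_mul]
    ring
  have hle : A ≤ ‖ℓ‖ * ‖x‖ := by
    rw [← hℓ, ← UniformSpace.Completion.norm_coe x]
    exact (Real.le_norm_self _).trans (ℓ.le_opNorm _)
  -- If $A>\|\ell\|^2$ then $\|x\|>\|\ell\|$, contradicting $\|x\|^2\le\|\ell\|\,\|x\|$.
  by_contra hc
  have h0 : 0 ≤ ‖ℓ‖ := norm_nonneg _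
  have h1 : 0 ≤ ‖x‖ := norm_nonneg _
  have h2 : ‖ℓ‖ < ‖x‖ := by
    rw [not_le, ← hx2] at hc
    exact lt_of_pow_lt_pow_left₀ 2 h1 hc
  nlinarith

end Series

end WhiteNoise

end

theorem corollary3p1 {Ω U ι X : Type*} [MeasurableSpace Ω]
    [NormedAddCommGroup U] [InnerProductSpace ℝ U] [CompleteSpace U]
    [TopologicalSpace.SeparableSpace U]
    [NormedAddCommGroup X] [InnerProductSpace ℝ X] [CompleteSpace X]
    [TopologicalSpace.SeparableSpace X]
    (P : Measure Ω) [IsProbabilityMeasure P]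
    (W : U → Ω → ℝ) (hW : WhiteNoise.IsWhiteNoise P W)
    (u : HilbertBasis ι ℝ U) (q : ι → ℝ) (hq : ∀ k, 1 ≤ q k) (r : ℝ)
    (ζ : (ι →₀ ℕ) → ℝ) :
    (WhiteNoise.MemLDual P W u q r ζ ↔
      Summable fun α : ι →₀ ℕ =>
        (α.degree.factorial : ℝ) * (α.prod fun k n => q k ^ (-2 * r * (n : ℝ))) * ζ α ^ 2) ∧
    ∀ ℓ : WhiteNoise.LDual P W u q r, WhiteNoise.IsFormalSeries ζ ℓ →
      ∀ η : WhiteNoise.LSpace P W u q r X,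
        HasSum (fun α : ι →₀ ℕ => ζ α • WhiteNoise.LSpace.coeff α η)
          (WhiteNoise.pairing η ℓ) := by
  simp only [← WhiteNoise.dualWeight_eq r hq]
  refine ⟨⟨fun ⟨ℓ, hℓ⟩ => hℓ.summable hW hq,
    fun h => ⟨_, WhiteNoise.isFormalSeries_seriesFunctional hW hq h⟩⟩, fun ℓ hℓ η => ?_⟩
  have hζ := hℓ.summable hW hq
  -- Uniqueness replaces the given functional by the explicit series, for which the scalar formula
  -- is known.
  obtain rfl := hℓ.unique hW (WhiteNoise.isFormalSeries_seriesFunctional hW hq hζ)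
  have hs := (WhiteNoise.LSpace.summable_norm_smul_coeff hW hq hζ η).of_norm.hasSum
  convert hs using 1
  -- The $X$-valued series already converges absolutely; pairing with `x` identifies its sum through
  -- the scalar case.
  refine ext_inner_left ℝ fun x => ?_
  rw [WhiteNoise.inner_pairing]
  refine (WhiteNoise.hasSum_seriesFunctional hW hq hζ _).unique ?_
  have h1 := hs.mapL (innerSL ℝ x)
  simpa only [innerSL_apply_apply, inner_smul_right, WhiteNoise.LSpace.coeff_inner hW hq,
    smul_eq_mul] using h1
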